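/- Let $G=(V,E)$ be a finite simple graph with $n$ vertices, $m$ edges and maximum degree $\Delta\ge 1$. Consider the following randomized algorithm. (1) Choose a permutation $\pi:E\to\{1,\dots,m\}$ uniformly at random. (2) Let $L\subseteq E$ contain each edge independently with probability $p=\Delta^{-0.85}$. (3) Let $k$ be $\Delta^{0.1}$ rounded up or down to an integer, and let every vertex choose independently and uniformly one of the parts $V_1,\dots,V_k$. (4) Machine $i\in\{1,\dots,k\}$ receives the graph $G^L[V_i]$, that is, the vertices of $V_i$ and the edges of $L$ with both endpoints in $V_i$ (with their ranks in $\pi$), and computes its greedy matching $M_i$: it processes these edges in the order of $\pi$ and adds an edge to $M_i$ if it shares no endpoint with an edge added before. (5) Return $M=\bigcup_{i=1}^k M_i$. The three random choices are independent. Space is counted in words, a word holding a vertex name, the index of a part, or the rank of an edge. The space of machine $i$ is the space needed to store $V_i$, the edges of $G^L[V_i]$ with their ranks, and $M_i$. The total space (aside from storing the input graph $G$) is the sum of the space of the $k$ machines and of the space needed to store the part of every vertex and the edges of $L$ with their ranks. For a vertex $v$, let $\deg_M^{\mathrm{res}}(v)$ be $0$ if $v$ is an endpoint of an edge of $M$,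 and otherwise the number of neighbours of $v$ in $G$ that are not endpoints of edges of $M$. There are absolute constants $c>0$, $C>0$ and $\Delta_0$ such that for every such $G$: 1. if $\Delta\ge\Delta_0$, then with probability at least $1-e^{-n^{c}}$ every machine uses at most $n/\Delta^{c}$ space; 2. with probability at least $1-e^{-n^{c}}$ the total space is at most $Cn+m/\Delta^{c}$; 3. the expected number of vertices $v\in V$ with $\deg_M^{\mathrm{res}}(v)>\Delta^{0.99}$ is at most $C\,n/\Delta^{0.03}$. -/

import Mathlib

namespace NearMaximal

noncomputable section

/-! ### Sequential greedy matching and residual degrees -/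

/-- Greedy maximal matching: go through the edges in the order of the list and add an edge iff it
shares no endpoint with an edge that was added before. -/
def greedyMatching {V : Type*} [DecidableEq V] (order : List (Sym2 V)) : Finset (Sym2 V) :=
  open Classical in
  order.foldl (fun M e => if ∀ f ∈ M, ∀ v : V, ¬ (v ∈ e ∧ v ∈ f) then insert e M else M) ∅

/-- The vertex `v` is covered by the edge set `M`. -/
def Covered {V : Type*} (M : Finset (Sym2 V)) (v : V) : Prop := ∃ e ∈ M, v ∈ e

/-- Residual degree of `v`: zero if `v` is matched, and otherwise the degree of `v` in the subgraph
of `G` induced on the unmatched vertices. -/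
def resDegree {V : Type*} [Fintype V] (G : SimpleGraph V) (M : Finset (Sym2 V)) (v : V) : ℕ :=
  open Classical in
  if Covered M v then 0 else (Finset.univ.filter fun u => G.Adj v u ∧ ¬ Covered M u).card

section Algorithm

variable {V : Type*} [Fintype V] [DecidableEq V] (G : SimpleGraph V) [DecidableRel G.Adj] (k : ℕ)

/-! ### The random choices of the algorithm -/

/-- The random choices: a permutation `π : E → {0, …, m-1}` of the edges, the set `L` of sampled
edges, and the part `χ v` of each vertex `v`. -/
abbrev Outcome : Type _ :=
  (G.edgeSet ≃ Fin (Fintype.card G.edgeSet)) × Finset G.edgeSet × (V → Fin k)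

/-- Edge-sampling probability `p = Δ^(-0.85)`. -/
def sampleProb : ℝ := (G.maxDegree : ℝ) ^ (-0.85 : ℝ)

/-- Probability that `L` is the set of sampled edges. -/
def sampleWeight (L : Finset G.edgeSet) : ℝ :=
  ∏ e : G.edgeSet, if e ∈ L then sampleProb G else 1 - sampleProb G

/-- Probability of a single outcome: `π` is uniform among the `m!` permutations, every edge is in
`L` independently with probability `p`, every vertex picks one of the `k` parts independently and
uniformly, and these three choices are independent of each other. -/
def weight (ω : Outcome G k) : ℝ :=
  (1 / (Nat.factorial (Fintype.card G.edgeSet) : ℝ)) *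
    sampleWeight G ω.2.1 *
    ∏ _v : V, (1 / (k : ℝ))

/-- Probability of an event. -/
def prob (A : Outcome G k → Prop) : ℝ :=
  open Classical in ∑ ω : Outcome G k, if A ω then weight G k ω else 0

/-- Expectation of a real random variable. -/
def expectation (f : Outcome G k → ℝ) : ℝ :=
  ∑ ω : Outcome G k, weight G k ω * f ω

/-! ### The algorithm -/

variable {G k}

/-- The part `V_i`. -/
def partVerts (ω : Outcome G k) (i : Fin k) : Finset V :=
  Finset.univ.filter fun v => ω.2.2 v = i

/-- The edges of `G^L[V_i]`: sampled edges with both endpoints in `V_i`. -/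
def partEdges (ω : Outcome G k) (i : Fin k) : Finset G.edgeSet :=
  open Classical in ω.2.1.filter fun e => ∀ v ∈ (e : Sym2 V), ω.2.2 v = i

/-- The edges of `G^L[V_i]` listed in the order of `π`. -/
def orderedPartEdges (ω : Outcome G k) (i : Fin k) : List (Sym2 V) :=
  ((List.ofFn fun j => ω.1.symm j).filter fun e => e ∈ partEdges ω i).map Subtype.val

/-- The greedy matching `M_i` computed by machine `i`. -/
def partMatching (ω : Outcome G k) (i : Fin k) : Finset (Sym2 V) :=
  greedyMatching (orderedPartEdges ω i)

/-- The output `M = ⋃ M_i`. -/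
def outputMatching (ω : Outcome G k) : Finset (Sym2 V) :=
  Finset.univ.biUnion fun i => partMatching ω i

/-- The number of vertices whose residual degree with respect to the output exceeds `Δ^0.99`. -/
def highResDegreeCount (ω : Outcome G k) : ℕ :=
  open Classical in
  (Finset.univ.filter fun v : V =>
    (G.maxDegree : ℝ) ^ (0.99 : ℝ) < (resDegree G (outputMatching ω) v : ℝ)).card

/-! ### Space, in words

A word holds the name of a vertex, the index of a part, or the rank of an edge. -/

/-- The data records that the algorithm stores. -/
inductive Datum (V : Type*) where
  /-- the name of a vertex -/
  | vertex (v : V)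
  /-- a vertex together with the index of its part -/
  | partOf (v : V) (i : ℕ)
  /-- an edge together with its rank in the permutation -/
  | rankedEdge (e : Sym2 V) (r : ℕ)
  /-- an edge of the computed matching -/
  | matchedEdge (e : Sym2 V)

/-- The number of words a record occupies. -/
def Datum.words {V : Type*} : Datum V → ℕ
  | .vertex _ => 1
  | .partOf _ _ => 2
  | .rankedEdge _ _ => 3
  | .matchedEdge _ => 2

/-- The number of words occupied by a collection of records. -/
def wordsOf {V : Type*} (D : Multiset (Datum V)) : ℕ := (D.map Datum.words).sum

/-- The data that machine `i` receives: the graph `G^L[V_i]` with the ranks of its edges. -/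
def received (ω : Outcome G k) (i : Fin k) : Multiset (Datum V) :=
  (partVerts ω i).val.map Datum.vertex +
    (partEdges ω i).val.map fun e : G.edgeSet => Datum.rankedEdge (e : Sym2 V) (ω.1 e : ℕ)

/-- The memory of machine `i` when it has computed `M_i`. Nothing is deleted before, so this is its
peak memory; the messages it receives and sends are contained in it. -/
def machineMemory (ω : Outcome G k) (i : Fin k) : Multiset (Datum V) :=
  received ω i + (partMatching ω i).val.map Datum.matchedEdge

/-- Space used by machine `i`. -/
def machineSpace (ω : Outcome G k) (i : Fin k) : ℕ := wordsOf (machineMemory ω i)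

/-- The results of the sampling and partitioning steps, stored across the system in addition to the
input graph: the part of every vertex, and the sampled edges with their ranks. -/
def randomizationData (ω : Outcome G k) : Multiset (Datum V) :=
  (Finset.univ : Finset V).val.map (fun v => Datum.partOf v (ω.2.2 v : ℕ)) +
    ω.2.1.val.map fun e : G.edgeSet => Datum.rankedEdge (e : Sym2 V) (ω.1 e : ℕ)

/-- Total space used, aside from the storage of the input graph. -/
def totalSpace (ω : Outcome G k) : ℕ :=
  wordsOf (randomizationData ω) + ∑ i : Fin k, machineSpace ω i

end Algorithm

end

end NearMaximal

open NearMaximal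

/-! Residual degrees. Fix the order π and the sample L, and let Y_i(v) be the number of neighbours
of v in part i that machine i leaves unmatched. The residual degree of an unmatched v is at most the
sum of the Y_i(v), and two facts keep it small.

In the part of v itself, Y is small on average. If v is unmatched, each edge from v to an unmatched
vertex of its part is unsampled, and inserting it into L would make the greedy process accept it. At
most one edge at v is ever accepted, so comparing the weights of L and of L with the edge inserted
bounds the expectation by 1/p (`sampleProb_mul_expected_freeNeighbors_le`).

All parts look alike. By symmetry the Y_i(v) have the same mean over the partition. Seen from
machine i, the vertices outside V_i are vertices covered from the start; moving one vertex changes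
this initial set in at most one element, and greedy matching then ends with at most one vertex of
different status (`DifferAtMostOne.greedyCover`). Only the neighbours of that vertex notice, so
Efron–Stein (`efronStein`, `sum_variance_le`) bounds the sum over v of the variances of Y_i(v) by
nΔ.

Hence a residual degree above T = Δ^0.99 forces Y to be at least T/(2k) in the own part of v, or
some squared deviation of order (T/k)² (`one_le_of_lt_sum`). Averaging gives n·2k/(pT) + 16k³nΔ/T²,
which is O(nΔ^(-0.04)).

Space. Memory is linear in the numbers of vertices and sampled edges held, so exponential moments
suffice. Averaging over L turns the exponent for one machine into a multiaffine polynomial in the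
indicators of V_i, whose partial derivatives are at most 1 after scaling by s of order Δ^(-0.15);
the indicators can then be replaced one by one by twice their mean (`expect_exp_le`). Markov and a
union bound over the machines finish the argument. -/

namespace NearMaximal

set_option linter.unusedSectionVars false

noncomputable section

/-! ### Greedy matching through its set of covered vertices -/

section Greedy

variable {V : Type*} [DecidableEq V]

open Classical in
/-- The covered set after one greedy step, started from the covered set `A`. -/
def coverStep (A : Finset V) (e : Sym2 V) : Finset V :=
  if ∀ v ∈ e, v ∉ A then A ∪ e.toFinset else A

/-- The covered set at the end of the greedy process, when `A` counts as covered at the start. -/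
def greedyCover (A : Finset V) (l : List (Sym2 V)) : Finset V := l.foldl coverStep A

open Classical in
/-- The edges accepted by the greedy process, when `A` counts as covered at the start. -/
def greedyAccepted : Finset V → List (Sym2 V) → Finset (Sym2 V)
  | _, [] => ∅
  | A, e :: l =>
    if ∀ v ∈ e, v ∉ A then insert e (greedyAccepted (coverStep A e) l) else greedyAccepted A l

@[simp] lemma greedyCover_nil (A : Finset V) : greedyCover A [] = A := rfl

@[simp] lemma greedyCover_cons (A : Finset V) (e : Sym2 V) (l : List (Sym2 V)) :
    greedyCover A (e :: l) = greedyCover (coverStep A e) l := rfl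

lemma greedyCover_append (A : Finset V) (l₁ l₂ : List (Sym2 V)) :
    greedyCover A (l₁ ++ l₂) = greedyCover (greedyCover A l₁) l₂ := by
  simp [greedyCover, List.foldl_append]

lemma subset_coverStep (A : Finset V) (e : Sym2 V) : A ⊆ coverStep A e := by
  unfold coverStep
  split_ifs
  · exact Finset.subset_union_left
  · exact subset_rfl

lemma subset_greedyCover (A : Finset V) (l : List (Sym2 V)) : A ⊆ greedyCover A l := by
  induction l generalizing A with
  | nil => simp
  | cons e l ih => exact (subset_coverStep A e).trans (ih _)

lemma exists_mem_coverStep (A : Finset V) (e : Sym2 V) : ∃ v ∈ e, v ∈ coverStep A e := by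
  unfold coverStep
  split_ifs with h
  · exact ⟨e.out.1, e.out_fst_mem, by simp [Sym2.out_fst_mem]⟩
  · push Not at h
    exact h

/-- The greedy process is maximal: every processed edge has a covered endpoint. -/
lemma exists_mem_greedyCover (A : Finset V) {l : List (Sym2 V)} {e : Sym2 V} (he : e ∈ l) :
    ∃ v ∈ e, v ∈ greedyCover A l := by
  obtain ⟨l₁, l₂, rfl⟩ := List.append_of_mem he
  obtain ⟨v, hv, hvc⟩ := exists_mem_coverStep (greedyCover A l₁) e
  refine ⟨v, hv, ?_⟩
  rw [greedyCover_append, greedyCover_cons]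
  exact subset_greedyCover _ _ hvc

lemma notMem_of_mem_greedyAccepted {A : Finset V} {l : List (Sym2 V)} {e : Sym2 V}
    (he : e ∈ greedyAccepted A l) : ∀ v ∈ e, v ∉ A := by
  induction l generalizing A with
  | nil => simp [greedyAccepted] at he
  | cons f l ih =>
    rw [greedyAccepted] at he
    split_ifs at he with h
    · rcases Finset.mem_insert.1 he with rfl | he
      · exact h
      · exact fun v hv hvA => ih he v hv (subset_coverStep A f hvA)
    · exact ih he

lemma mem_coverStep_of_free {A : Finset V} {e : Sym2 V} (h : ∀ v ∈ e, v ∉ A) {v : V}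
    (hv : v ∈ e) : v ∈ coverStep A e := by
  simp [coverStep, if_pos h, hv]

/-- Accepted edges form a matching. -/
lemma eq_of_mem_greedyAccepted {A : Finset V} {l : List (Sym2 V)} {e f : Sym2 V}
    (he : e ∈ greedyAccepted A l) (hf : f ∈ greedyAccepted A l) {v : V} (hve : v ∈ e)
    (hvf : v ∈ f) : e = f := by
  induction l generalizing A with
  | nil => simp [greedyAccepted] at he
  | cons g l ih =>
    rw [greedyAccepted] at he hf
    split_ifs at he hf with h
    · rcases Finset.mem_insert.1 he with rfl | he <;> rcases Finset.mem_insert.1 hf with rfl | hf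
      · rfl
      · exact absurd (mem_coverStep_of_free h hve) (notMem_of_mem_greedyAccepted hf v hvf)
      · exact absurd (mem_coverStep_of_free h hvf) (notMem_of_mem_greedyAccepted he v hve)
      · exact ih he hf
    · exact ih he hf

/-- An edge that is free at the end of the process would have been accepted at any time. -/
lemma mem_greedyAccepted_insert {A : Finset V} {l₁ l₂ : List (Sym2 V)} {e : Sym2 V}
    (h : ∀ v ∈ e, v ∉ greedyCover A (l₁ ++ l₂)) : e ∈ greedyAccepted A (l₁ ++ e :: l₂) := by
  induction l₁ generalizing A with
  | nil =>
    have : ∀ v ∈ e, v ∉ A := fun v hv hA => h v hv (subset_greedyCover _ _ hA)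
    simp [greedyAccepted, if_pos this]
  | cons f l ih =>
    rw [List.cons_append, greedyCover_cons] at h
    rw [List.cons_append, greedyAccepted]
    split_ifs with hf
    · exact Finset.mem_insert_of_mem (ih h)
    · rw [coverStep, if_neg hf] at h
      exact ih h

/-- `A` and `B` differ in at most one element. -/
def DifferAtMostOne (A B : Finset V) : Prop := ∃ x : V, ∀ y, y ≠ x → (y ∈ A ↔ y ∈ B)

lemma DifferAtMostOne.symm {W : Type*} {A B : Finset W} (h : DifferAtMostOne A B) : DifferAtMostOne B A :=
  h.imp fun _ hx y hy => (hx y hy).symm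

/-- Let x be the only disagreement, covered in A but not in B. An edge avoiding x is treated alike
on both sides. An edge xy is blocked in A; if B accepts it, x becomes covered on both sides and only
y can still differ. The disagreement thus moves along an alternating path. -/
lemma DifferAtMostOne.coverStep {A B : Finset V} (h : DifferAtMostOne A B) (e : Sym2 V) :
    DifferAtMostOne (coverStep A e) (coverStep B e) := by
  obtain ⟨x, hx⟩ := h
  wlog hA : x ∈ A generalizing A B with H
  · by_cases hB : x ∈ B
    · exact (H (fun y hy => (hx y hy).symm) hB).symm
    · have : A = B := by
        ext y
        by_cases hy : y = x
        · subst hy; simp [hA, hB]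
        · exact hx y hy
      subst this
      exact ⟨x, fun _ _ => Iff.rfl⟩
  by_cases hB : x ∈ B
  · have : A = B := by
      ext y
      by_cases hy : y = x
      · subst hy; simp [hA, hB]
      · exact hx y hy
    subst this
    exact ⟨x, fun _ _ => Iff.rfl⟩
  by_cases hxe : x ∈ e
  · obtain ⟨y, rfl⟩ := Sym2.mem_iff_exists.1 hxe
    have h1 : ¬ ∀ v ∈ s(x, y), v ∉ A := fun h => h x hxe hA
    rw [NearMaximal.coverStep, if_neg h1, NearMaximal.coverStep]
    split_ifs with h2
    · refine ⟨y, fun z hz => ?_⟩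
      by_cases hzx : z = x
      · subst hzx; simp [hA]
      · simp [hx z hzx, hz, hzx]
    · exact ⟨x, hx⟩
  · have hiff : (∀ v ∈ e, v ∉ A) ↔ ∀ v ∈ e, v ∉ B := by
      refine forall₂_congr fun v hv => not_congr (hx v ?_)
      rintro rfl
      exact hxe hv
    refine ⟨x, fun y hy => ?_⟩
    unfold NearMaximal.coverStep
    by_cases hf : ∀ v ∈ e, v ∉ B
    · rw [if_pos hf, if_pos (hiff.2 hf)]
      simp [hx y hy]
    · rw [if_neg hf, if_neg (mt hiff.1 hf)]
      exact hx y hy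

/-- Changing the set of initially covered vertices in one vertex changes the status of at most one
vertex at the end of the greedy process. -/
lemma DifferAtMostOne.greedyCover {A B : Finset V} (h : DifferAtMostOne A B)
    (l : List (Sym2 V)) : DifferAtMostOne (greedyCover A l) (greedyCover B l) := by
  induction l generalizing A B with
  | nil => exact h
  | cons e l ih => exact ih (h.coverStep e)

/-- One step of `greedyMatching`. -/
def matchStep (M : Finset (Sym2 V)) (e : Sym2 V) : Finset (Sym2 V) :=
  open Classical in
  if ∀ f ∈ M, ∀ v : V, ¬ (v ∈ e ∧ v ∈ f) then insert e M else M

lemma greedyMatching_eq_foldl (l : List (Sym2 V)) : greedyMatching l = l.foldl matchStep ∅ := rfl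

lemma card_foldl_matchStep_le (l : List (Sym2 V)) (M : Finset (Sym2 V)) :
    (l.foldl matchStep M).card ≤ M.card + l.length := by
  induction l generalizing M with
  | nil => simp
  | cons e l ih =>
    refine (ih _).trans ?_
    have : (matchStep M e).card ≤ M.card + 1 := by
      unfold matchStep
      split_ifs
      · exact Finset.card_insert_le _ _
      · omega
    simp only [List.length_cons]
    omega

lemma card_greedyMatching_le (l : List (Sym2 V)) : (greedyMatching l).card ≤ l.length := by
  rw [greedyMatching_eq_foldl]
  simpa using card_foldl_matchStep_le l ∅

/-- Running greedy on the edges inside S amounts to running it on all edges with the complement of S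
covered from the start. The invariant is that `A` is the complement of S together with the matched
vertices. This confines the dependence on the partition to the initial covered set. -/
lemma covered_foldl_matchStep_iff (S : V → Prop) [DecidablePred fun e : Sym2 V => ∀ v ∈ e, S v]
    (l : List (Sym2 V)) (M : Finset (Sym2 V)) (A : Finset V)
    (hA : ∀ v, v ∈ A ↔ (S v → Covered M v)) (hM : ∀ v, Covered M v → S v) :
    let M' := (l.filter fun e => ∀ v ∈ e, S v).foldl matchStep M
    (∀ v, v ∈ greedyCover A l ↔ (S v → Covered M' v)) ∧ ∀ v, Covered M' v → S v := by
  induction l generalizing M A with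
  | nil => exact ⟨hA, hM⟩
  | cons e l ih =>
    by_cases he : ∀ v ∈ e, S v
    · have hfree : (∀ f ∈ M, ∀ v : V, ¬ (v ∈ e ∧ v ∈ f)) ↔ ∀ v ∈ e, v ∉ A := by
        constructor
        · intro h v hv hvA
          obtain ⟨f, hf, hvf⟩ := (hA v).1 hvA (he v hv)
          exact h f hf v ⟨hv, hvf⟩
        · rintro h f hf v ⟨hv, hvf⟩
          exact h v hv ((hA v).2 fun _ => ⟨f, hf, hvf⟩)
      have hcov : ∀ v, Covered (matchStep M e) v ↔
          Covered M v ∨ ((∀ v ∈ e, v ∉ A) ∧ v ∈ e) := by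
        intro v
        unfold matchStep Covered
        split_ifs with h
        · have := hfree.1 h
          simp only [Finset.mem_insert, exists_eq_or_imp]
          exact ⟨fun h => h.elim (fun h => Or.inr ⟨this, h⟩) Or.inl,
            fun h => h.elim Or.inr fun h => Or.inl h.2⟩
        · exact ⟨Or.inl, fun h' => h'.elim id fun h' => absurd (hfree.2 h'.1) h⟩
      have hmem : ∀ v, v ∈ coverStep A e ↔ v ∈ A ∨ ((∀ v ∈ e, v ∉ A) ∧ v ∈ e) := by
        intro v
        unfold coverStep
        split_ifs with h
        · simp only [Finset.mem_union, Sym2.mem_toFinset]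
          tauto
        · tauto
      rw [List.filter_cons_of_pos (by simpa using he)]
      refine ih (matchStep M e) (coverStep A e) (fun v => ?_) (fun v hv => ?_)
      · rw [hmem, hcov, hA]
        have := he v
        tauto
      · rcases (hcov v).1 hv with h | h
        · exact hM v h
        · exact he v h.2
    · rw [List.filter_cons_of_neg (by simpa using he)]
      have : coverStep A e = A := by
        refine if_neg fun h => he fun v hv => ?_
        by_contra hS
        exact h v hv ((hA v).2 fun h => absurd h hS)
      rw [greedyCover_cons, this]
      exact ih M A hA hM

end Greedy

/-! ### The algorithm in terms of covered sets -/

section Link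

variable {V : Type*} [Fintype V] [DecidableEq V] {G : SimpleGraph V} [DecidableRel G.Adj] {k : ℕ}

/-- The vertices outside part `i`. -/
def outside (χ : V → Fin k) (i : Fin k) : Finset V := Finset.univ.filter fun v => χ v ≠ i

/-- The edges of `L` in the order of the list `o`. -/
def sampledList (o : List G.edgeSet) (L : Finset G.edgeSet) : List (Sym2 V) :=
  (o.filter fun e => e ∈ L).map Subtype.val

/-- The vertices that are covered when machine `i` is done, together with those outside part
`i`. -/
def coverOrOutside (o : List G.edgeSet) (L : Finset G.edgeSet) (χ : V → Fin k) (i : Fin k) :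
    Finset V :=
  greedyCover (outside χ i) (sampledList o L)

/-- The edges in the order of a permutation. -/
def edgeOrder (π : G.edgeSet ≃ Fin (Fintype.card G.edgeSet)) : List G.edgeSet :=
  List.ofFn fun j => π.symm j

lemma orderedPartEdges_eq (ω : Outcome G k) (i : Fin k) :
    orderedPartEdges ω i =
      (sampledList (edgeOrder ω.1) ω.2.1).filter
        fun e => open Classical in decide (∀ v ∈ e, ω.2.2 v = i) := by
  unfold orderedPartEdges sampledList edgeOrder
  rw [List.filter_map, List.filter_filter]
  congr 1
  refine List.filter_congr fun e _ => ?_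
  simp [partEdges, Bool.and_comm]

lemma covered_partMatching (ω : Outcome G k) (i : Fin k) :
    (∀ v, v ∈ coverOrOutside (edgeOrder ω.1) ω.2.1 ω.2.2 i ↔
      (ω.2.2 v = i → Covered (partMatching ω i) v)) ∧
      ∀ v, Covered (partMatching ω i) v → ω.2.2 v = i := by
  classical
  have := covered_foldl_matchStep_iff (fun v => ω.2.2 v = i)
    (sampledList (edgeOrder ω.1) ω.2.1) ∅ (outside ω.2.2 i)
    (by simp [outside, Covered]) (by simp [Covered])
  unfold partMatching coverOrOutside
  rw [orderedPartEdges_eq, greedyMatching_eq_foldl]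
  convert this

lemma covered_outputMatching_iff (ω : Outcome G k) (v : V) :
    Covered (outputMatching ω) v ↔ ∃ i, Covered (partMatching ω i) v := by
  unfold Covered outputMatching
  simp only [Finset.mem_biUnion, Finset.mem_univ, true_and]
  tauto

/-- Machine i only matches vertices of its own part, so for a vertex of part i being missed by
machine i is the same as being missed by the whole output. -/
lemma notMem_coverOrOutside_iff (ω : Outcome G k) (i : Fin k) (v : V) :
    v ∉ coverOrOutside (edgeOrder ω.1) ω.2.1 ω.2.2 i ↔
      ω.2.2 v = i ∧ ¬ Covered (outputMatching ω) v := by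
  rw [(covered_partMatching ω i).1, covered_outputMatching_iff]
  constructor
  · intro h
    push Not at h
    refine ⟨h.1, fun ⟨j, hj⟩ => ?_⟩
    have := (covered_partMatching ω j).2 v hj
    rw [h.1] at this
    exact h.2 (this ▸ hj)
  · rintro ⟨h, h'⟩ hc
    exact h' ⟨i, hc h⟩

/-- The number of neighbours of `v` in part `i` that machine `i` leaves unmatched. -/
def freeNeighbors (o : List G.edgeSet) (L : Finset G.edgeSet) (v : V) (χ : V → Fin k)
    (i : Fin k) : ℕ :=
  (Finset.univ.filter fun u => G.Adj v u ∧ u ∉ coverOrOutside o L χ i).card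

lemma resDegree_outputMatching_le (ω : Outcome G k) (v : V) :
    resDegree G (outputMatching ω) v ≤
      ∑ i, freeNeighbors (edgeOrder ω.1) ω.2.1 v ω.2.2 i := by
  classical
  unfold resDegree freeNeighbors
  split_ifs
  · exact Nat.zero_le _
  · refine le_trans (Finset.card_le_card ?_) Finset.card_biUnion_le
    intro u hu
    simp only [Finset.mem_filter, Finset.mem_univ, true_and, Finset.mem_biUnion] at hu ⊢
    exact ⟨ω.2.2 u, hu.1, (notMem_coverOrOutside_iff ω _ u).2 ⟨rfl, hu.2⟩⟩

lemma notMem_coverOrOutside_of_resDegree_pos (ω : Outcome G k) {v : V}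
    (h : 0 < resDegree G (outputMatching ω) v) :
    v ∉ coverOrOutside (edgeOrder ω.1) ω.2.1 ω.2.2 (ω.2.2 v) := by
  rw [notMem_coverOrOutside_iff]
  refine ⟨rfl, fun hc => ?_⟩
  simp [resDegree, hc] at h

end Link

/-! ### Resampling one coordinate and the Efron–Stein inequality -/

section ProductSpace

open scoped BigOperators

variable {V β : Type*} [DecidableEq V] [Fintype β]

/-- Average of `f` over the coordinate `w`. -/
def avgAt (w : V) (f : (V → β) → ℝ) (χ : V → β) : ℝ := 𝔼 j, f (Function.update χ w j)

lemma avgAt_congr {f : (V → β) → ℝ} {w : V} {χ χ' : V → β} (h : ∀ v, v ≠ w → χ v = χ' v) :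
    avgAt w f χ = avgAt w f χ' := by
  unfold avgAt
  congr 1
  funext j
  congr 1
  funext v
  by_cases hv : v = w
  · subst hv; simp
  · simp [hv, h v hv]

lemma avgAt_mul_avgAt (w : V) (f h : (V → β) → ℝ) (χ : V → β) :
    avgAt w (fun χ => f χ * avgAt w h χ) χ = avgAt w f χ * avgAt w h χ := by
  have : ∀ j, avgAt w h (Function.update χ w j) = avgAt w h χ := fun j =>
    avgAt_congr fun v hv => by simp [hv]
  rw [avgAt]
  simp_rw [this, ← Finset.expect_mul]
  rfl

/-- Successive averages over the coordinates in a list. -/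
def avgList (l : List V) (f : (V → β) → ℝ) : (V → β) → ℝ := l.foldr avgAt f

lemma avgList_congr {f : (V → β) → ℝ} {l : List V} {χ χ' : V → β}
    (h : ∀ v, v ∉ l → χ v = χ' v) : avgList l f χ = avgList l f χ' := by
  induction l generalizing χ χ' with
  | nil =>
    have : χ = χ' := funext fun v => h v (by simp)
    rw [this]
  | cons w l ih =>
    change avgAt w (avgList l f) χ = avgAt w (avgList l f) χ'
    unfold avgAt
    congr 1
    funext j
    refine ih fun v hv => ?_
    by_cases hvw : v = w
    · subst hvw; simp
    · simp [hvw, h v (by simp [hvw, hv])]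

lemma avgAt_sub (w : V) (f g : (V → β) → ℝ) (χ : V → β) :
    avgAt w (fun χ => f χ - g χ) χ = avgAt w f χ - avgAt w g χ :=
  Finset.expect_sub_distrib _ _ _

variable [Fintype V] [Nonempty β]

/-- Exchanging the coordinate at w with an independent fresh value is an involution, so it preserves
the uniform measure. -/
lemma expect_avgAt (w : V) (f : (V → β) → ℝ) : 𝔼 χ, avgAt w f χ = 𝔼 χ, f χ := by
  have hinv : Function.Involutive
      fun x : (V → β) × β => (Function.update x.1 w x.2, x.1 w) := by
    rintro ⟨χ, j⟩
    simp
  have h1 : 𝔼 χ, avgAt w f χ = 𝔼 x : (V → β) × β, f (Function.update x.1 w x.2) := by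
    unfold avgAt
    rw [← Finset.univ_product_univ, Finset.expect_product]
  have h2 : 𝔼 χ, f χ = 𝔼 x : (V → β) × β, f x.1 := by
    rw [← Finset.univ_product_univ, Finset.expect_product]
    simp
  rw [h1, h2]
  exact Fintype.expect_equiv hinv.toPerm _ _ fun x => rfl

lemma expect_mul_avgAt (w : V) (f h : (V → β) → ℝ) :
    𝔼 χ, f χ * avgAt w h χ = 𝔼 χ, avgAt w f χ * avgAt w h χ := by
  rw [← expect_avgAt w]
  simp_rw [avgAt_mul_avgAt]

/-- Pythagoras for the projection `avgAt w`. -/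
lemma expect_sq_sub_avgAt_add (w : V) (f h : (V → β) → ℝ) :
    𝔼 χ, (f χ - avgAt w f χ + avgAt w h χ) ^ 2 =
      𝔼 χ, (f χ - avgAt w f χ) ^ 2 + 𝔼 χ, avgAt w h χ ^ 2 := by
  have h1 := expect_mul_avgAt w f h
  have h2 : ∀ χ, (f χ - avgAt w f χ + avgAt w h χ) ^ 2 =
      (f χ - avgAt w f χ) ^ 2 + avgAt w h χ ^ 2 +
        2 * (f χ * avgAt w h χ - avgAt w f χ * avgAt w h χ) := fun χ => by ring
  simp_rw [h2, Finset.expect_add_distrib, ← Finset.mul_expect, Finset.expect_sub_distrib]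
  rw [h1]
  ring

lemma expect_avgAt_sq_le (w : V) (h : (V → β) → ℝ) :
    𝔼 χ, avgAt w h χ ^ 2 ≤ 𝔼 χ, h χ ^ 2 := by
  have := expect_sq_sub_avgAt_add w h h
  simp only [sub_add_cancel] at this
  have h0 : 0 ≤ 𝔼 χ, (h χ - avgAt w h χ) ^ 2 := Finset.expect_nonneg fun _ _ => sq_nonneg _
  linarith

lemma expect_avgList (l : List V) (f : (V → β) → ℝ) : 𝔼 χ, avgList l f χ = 𝔼 χ, f χ := by
  induction l with
  | nil => rfl
  | cons w l ih => exact (expect_avgAt w _).trans ih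

/-- Split off `f - avgAt w f`; the remainder is `avgAt w` of the difference for the shorter list.
The two pieces are orthogonal, and `avgAt w` is an L² contraction. -/
lemma expect_sq_sub_avgList_le (l : List V) (f : (V → β) → ℝ) :
    𝔼 χ, (f χ - avgList l f χ) ^ 2 ≤ (l.map fun w => 𝔼 χ, (f χ - avgAt w f χ) ^ 2).sum := by
  induction l with
  | nil => simp [avgList]
  | cons w l ih =>
    have h1 : ∀ χ, f χ - avgList (w :: l) f χ =
        f χ - avgAt w f χ + avgAt w (fun χ => f χ - avgList l f χ) χ := fun χ => by
      rw [avgAt_sub]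
      change f χ - avgAt w (avgList l f) χ = _
      ring
    simp_rw [h1, List.map_cons, List.sum_cons]
    rw [expect_sq_sub_avgAt_add]
    gcongr
    exact (expect_avgAt_sq_le w _).trans ih

/-- The Efron–Stein inequality for the uniform distribution on a finite product. -/
theorem efronStein (f : (V → β) → ℝ) :
    𝔼 χ, (f χ - 𝔼 χ', f χ') ^ 2 ≤ ∑ w, 𝔼 χ, (f χ - avgAt w f χ) ^ 2 := by
  -- Once every coordinate has been averaged the result is constant, hence equal to its own mean.
  have h : ∀ χ, avgList Finset.univ.toList f χ = 𝔼 χ', f χ' := fun χ => by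
    rw [← expect_avgList Finset.univ.toList f, ← Fintype.expect_const (ι := V → β)
      (avgList Finset.univ.toList f χ)]
    exact Finset.expect_congr rfl fun χ' _ => avgList_congr (by simp)
  have := expect_sq_sub_avgList_le Finset.univ.toList f
  simp_rw [h] at this
  rwa [Finset.sum_map_toList] at this

lemma sq_expect_le {ι : Type*} [Fintype ι] [Nonempty ι] (g : ι → ℝ) :
    (𝔼 i, g i) ^ 2 ≤ 𝔼 i, g i ^ 2 := by
  have := Finset.expect_mul_sq_le_sq_mul_sq Finset.univ g fun _ => 1
  simpa using this

/-- Efron–Stein for a family of functions whose total squared change under a change of one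
coordinate is bounded. -/
theorem sum_variance_le {ι : Type*} [Fintype ι] (f : ι → (V → β) → ℝ) (D : ℝ)
    (hf : ∀ χ w j, ∑ a, (f a χ - f a (Function.update χ w j)) ^ 2 ≤ D) :
    ∑ a, 𝔼 χ, (f a χ - 𝔼 χ', f a χ') ^ 2 ≤ Fintype.card V * D := by
  calc ∑ a, 𝔼 χ, (f a χ - 𝔼 χ', f a χ') ^ 2
      ≤ ∑ a, ∑ w, 𝔼 χ, (f a χ - avgAt w (f a) χ) ^ 2 :=
        Finset.sum_le_sum fun a _ => efronStein (f a)
    _ = ∑ w, 𝔼 χ, ∑ a, (f a χ - avgAt w (f a) χ) ^ 2 := by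
        rw [Finset.sum_comm]
        exact Finset.sum_congr rfl fun w _ => (Finset.expect_sum_comm _ _ _).symm
    _ ≤ ∑ _w : V, D := by
        refine Finset.sum_le_sum fun w _ => Finset.expect_le Finset.univ_nonempty fun χ _ => ?_
        -- The deviation from `avgAt` is an average of one-coordinate changes, so Jensen applies.
        calc ∑ a, (f a χ - avgAt w (f a) χ) ^ 2
            ≤ ∑ a, 𝔼 j, (f a χ - f a (Function.update χ w j)) ^ 2 := by
              refine Finset.sum_le_sum fun a _ => ?_
              refine le_trans (le_of_eq ?_) (sq_expect_le _)
              rw [Finset.expect_sub_distrib, Fintype.expect_const]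
              rfl
          _ = 𝔼 j, ∑ a, (f a χ - f a (Function.update χ w j)) ^ 2 :=
              (Finset.expect_sum_comm _ _ _).symm
          _ ≤ D := Finset.expect_le Finset.univ_nonempty fun j _ => hf χ w j
    _ = Fintype.card V * D := by simp

end ProductSpace

/-! ### Exponential moments of multiaffine functions -/

section ExponentialMoment

open scoped BigOperators

variable {V β : Type*} [Fintype V] [DecidableEq V] [Fintype β] [Nonempty β] [DecidableEq β]

lemma exp_sub_one_le_two_mul {x : ℝ} (h0 : 0 ≤ x) (h1 : x ≤ 1) : Real.exp x - 1 ≤ 2 * x := by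
  have := Real.abs_exp_sub_one_le (x := x) (by rwa [abs_of_nonneg h0])
  rw [abs_of_nonneg h0] at this
  exact (le_abs_self _).trans this

/-- For a multiaffine `F` with partial derivatives in `[0, 1]` on the unit cube, the exponential
moment of `F` at independent indicators of probability `q` is at most `exp (F (2q, …, 2q))`. -/
theorem expect_exp_le (F : (V → ℝ) → ℝ) (i : β) {q : ℝ} (hq : q = 1 / Fintype.card β)
    (hq2 : 2 * q ≤ 1)
    (hF : ∀ x : V → ℝ, (∀ v, 0 ≤ x v) → (∀ v, x v ≤ 1) → ∀ w, ∃ D, 0 ≤ D ∧ D ≤ 1 ∧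
      ∀ t, F (Function.update x w t) = F (Function.update x w 0) + t * D) :
    𝔼 χ : V → β, Real.exp (F fun v => if χ v = i then 1 else 0) ≤
      Real.exp (F fun _ => 2 * q) := by
  have hq0 : 0 ≤ q := by rw [hq]; positivity
  -- Hybrid argument: on S the random indicators have already been replaced by the constant 2q.
  have key : ∀ S : Finset V, 𝔼 χ : V → β, Real.exp (F fun v => if χ v = i then 1 else 0) ≤
      𝔼 χ : V → β, Real.exp (F fun v => if v ∈ S then 2 * q else if χ v = i then 1 else 0) := by
    intro S
    induction S using Finset.induction_on with
    | empty => simp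
    | insert w S hw ih =>
      refine ih.trans ?_
      rw [← expect_avgAt w]
      refine Finset.expect_le_expect fun χ _ => ?_
      set y : V → ℝ := fun v => if v ∈ insert w S then 2 * q else if χ v = i then 1 else 0 with hy
      have hy0 : ∀ v, 0 ≤ y v := fun v => by
        simp only [hy]; split_ifs <;> positivity
      have hy1 : ∀ v, y v ≤ 1 := fun v => by
        simp only [hy]; split_ifs <;> first | exact hq2 | norm_num
      obtain ⟨D, hD0, hD1, hD⟩ := hF y hy0 hy1 w
      have h1 : ∀ j, (fun v => if v ∈ S then 2 * q else
          if Function.update χ w j v = i then 1 else 0) =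
          Function.update y w (if j = i then 1 else 0) := by
        intro j
        funext v
        by_cases hv : v = w
        · subst hv; simp [hw]
        · simp [hv, hy]
      have h2 : y = Function.update y w (2 * q) := by
        funext v
        by_cases hv : v = w
        · subst hv; simp [hy]
        · simp [hv]
      have h3 : ∀ j, Real.exp (F (Function.update y w (if j = i then 1 else 0))) =
          Real.exp (F (Function.update y w 0)) *
            (1 + if j = i then Real.exp D - 1 else 0) := by
        intro j
        rw [hD, Real.exp_add]
        split_ifs <;> simp
      rw [avgAt]
      simp_rw [h1, h3]
      rw [← Finset.mul_expect, Finset.expect_add_distrib, Fintype.expect_const, h2, hD,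
        Real.exp_add, Fintype.expect_eq_sum_div_card, Finset.sum_ite_eq']
      simp only [Finset.mem_univ, if_true, Function.update_idem]
      refine mul_le_mul_of_nonneg_left ?_ (Real.exp_pos _).le
      -- Averaging over the part of w gives the factor 1 + q(e^D - 1) ≤ 1 + 2qD ≤ e^(2qD), which is
      -- the effect of setting coordinate w to 2q.
      have h4 : (Real.exp D - 1) / Fintype.card β ≤ 2 * q * D := by
        have := mul_le_mul_of_nonneg_left (exp_sub_one_le_two_mul hD0 hD1) hq0
        rw [hq] at this ⊢
        calc _ = 1 / (Fintype.card β : ℝ) * (Real.exp D - 1) := by ring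
          _ ≤ _ := this
          _ = _ := by ring
      linarith [Real.add_one_le_exp (2 * q * D)]
  refine (key Finset.univ).trans (le_of_eq ?_)
  simp

end ExponentialMoment

/-! ### Edge sampling and the insertion argument -/

section Sampling

open scoped BigOperators

variable {V : Type*} [Fintype V] [DecidableEq V] {G : SimpleGraph V} [DecidableRel G.Adj] {k : ℕ}

lemma sampleProb_nonneg : 0 ≤ sampleProb G := Real.rpow_nonneg (Nat.cast_nonneg _) _

lemma sampleProb_le_one (hΔ : 1 ≤ G.maxDegree) : sampleProb G ≤ 1 :=
  Real.rpow_le_one_of_one_le_of_nonpos (by exact_mod_cast hΔ) (by norm_num)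

lemma sampleProb_pos (hΔ : 1 ≤ G.maxDegree) : 0 < sampleProb G :=
  Real.rpow_pos_of_pos (by exact_mod_cast hΔ) _

lemma sampleWeight_nonneg (hΔ : 1 ≤ G.maxDegree) (L : Finset G.edgeSet) :
    0 ≤ sampleWeight G L := by
  refine Finset.prod_nonneg fun e _ => ?_
  split_ifs
  · exact sampleProb_nonneg
  · linarith [sampleProb_le_one hΔ]

lemma sampleWeight_eq (L : Finset G.edgeSet) :
    sampleWeight G L = (∏ _e ∈ L, sampleProb G) * ∏ _e ∈ Finset.univ \ L, (1 - sampleProb G) := by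
  unfold sampleWeight
  rw [Finset.prod_ite, Finset.filter_mem_eq_inter, Finset.univ_inter, Finset.filter_notMem_eq_sdiff]

/-- Expanding the product on the right, the set of factors from which the first summand is taken is
L. -/
lemma sum_sampleWeight_mul_prod (z : G.edgeSet → ℝ) :
    ∑ L, sampleWeight G L * ∏ e ∈ L, z e =
      ∏ e : G.edgeSet, (sampleProb G * z e + (1 - sampleProb G)) := by
  rw [Finset.prod_add, Finset.powerset_univ]
  refine Finset.sum_congr rfl fun L _ => ?_
  rw [sampleWeight_eq, Finset.prod_mul_distrib, mul_right_comm]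

lemma sum_sampleWeight : ∑ L, sampleWeight G L = 1 := by
  have := sum_sampleWeight_mul_prod (G := G) fun _ => 1
  simpa using this

lemma sampleWeight_insert {L : Finset G.edgeSet} {e : G.edgeSet} (he : e ∉ L) :
    (1 - sampleProb G) * sampleWeight G (insert e L) = sampleProb G * sampleWeight G L := by
  unfold sampleWeight
  rw [← Finset.mul_prod_erase Finset.univ _ (Finset.mem_univ e),
    ← Finset.mul_prod_erase Finset.univ (fun x => if x ∈ L then _ else _) (Finset.mem_univ e),
    if_pos (Finset.mem_insert_self e L), if_neg he]
  have : ∏ x ∈ Finset.univ.erase e, (if x ∈ insert e L then sampleProb G else 1 - sampleProb G) =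
      ∏ x ∈ Finset.univ.erase e, (if x ∈ L then sampleProb G else 1 - sampleProb G) := by
    refine Finset.prod_congr rfl fun x hx => ?_
    simp [Finset.ne_of_mem_erase hx]
  rw [this]
  ring

/-- Exponential moment of a sum over the sampled edges. -/
lemma sum_sampleWeight_mul_exp_le (hΔ : 1 ≤ G.maxDegree) (z : G.edgeSet → ℝ)
    (h0 : ∀ e, 0 ≤ z e) (h1 : ∀ e, z e ≤ 1) :
    ∑ L, sampleWeight G L * Real.exp (∑ e ∈ L, z e) ≤
      Real.exp (2 * sampleProb G * ∑ e, z e) := by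
  simp_rw [Real.exp_sum]
  rw [sum_sampleWeight_mul_prod, Finset.mul_sum, Real.exp_sum]
  refine Finset.prod_le_prod (fun e _ => ?_) fun e _ => ?_
  · have := sampleProb_le_one hΔ
    have := mul_nonneg (sampleProb_nonneg (G := G)) (Real.exp_pos (z e)).le
    linarith
  · have h2 := mul_le_mul_of_nonneg_left (exp_sub_one_le_two_mul (h0 e) (h1 e))
      (sampleProb_nonneg (G := G))
    have h3 := Real.add_one_le_exp (2 * sampleProb G * z e)
    linarith

lemma mem_sampledList {o : List G.edgeSet} (ho : ∀ e, e ∈ o) {L : Finset G.edgeSet}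
    {e : G.edgeSet} (he : e ∈ L) : (e : Sym2 V) ∈ sampledList o L := by
  simp only [sampledList, List.mem_map, List.mem_filter]
  exact ⟨e, ⟨ho e, by simpa using he⟩, rfl⟩

lemma sampledList_insert {o : List G.edgeSet} (ho : ∀ e, e ∈ o) (hn : o.Nodup)
    {L : Finset G.edgeSet} {e : G.edgeSet} (he : e ∉ L) :
    ∃ l₁ l₂, sampledList o L = l₁ ++ l₂ ∧ sampledList o (insert e L) = l₁ ++ (e : Sym2 V) :: l₂ := by
  obtain ⟨a, b, rfl⟩ := List.append_of_mem (ho e)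
  have hea : e ∉ a := fun h => by
    rw [List.nodup_append] at hn
    exact hn.2.2 e h e (by simp) rfl
  have heb : e ∉ b := by
    rw [List.nodup_append] at hn
    exact (List.nodup_cons.1 hn.2.1).1
  have hfil : ∀ c : List G.edgeSet, e ∉ c →
      c.filter (fun x => decide (x ∈ insert e L)) = c.filter fun x => decide (x ∈ L) := by
    intro c hc
    refine List.filter_congr fun x hx => ?_
    have : x ≠ e := fun h => hc (h ▸ hx)
    simp [this]
  refine ⟨sampledList a L, sampledList b L, ?_, ?_⟩
  · simp [sampledList, he]
  · simp only [sampledList, List.filter_append, List.map_append, hfil a hea]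
    rw [List.filter_cons_of_pos (by simp), hfil b heb, List.map_cons]

/-- If `v` stays unmatched, then it has in expectation at most `1/p` unmatched neighbours in its
own part: sampling any of the free edges at `v` in addition would have matched `v` by that edge. -/
theorem sampleProb_mul_expected_freeNeighbors_le (hΔ : 1 ≤ G.maxDegree) {o : List G.edgeSet}
    (ho : ∀ e, e ∈ o) (hn : o.Nodup) (χ : V → Fin k) (i : Fin k) (v : V) :
    sampleProb G * ∑ L, sampleWeight G L *
      (if v ∉ coverOrOutside o L χ i then (freeNeighbors o L v χ i : ℝ) else 0) ≤ 1 := by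
  classical
  set free : Finset G.edgeSet → G.edgeSet → Prop := fun L e =>
    v ∈ (e : Sym2 V) ∧ ∀ x ∈ (e : Sym2 V), x ∉ coverOrOutside o L χ i with hfree
  set hit : Finset G.edgeSet → G.edgeSet → Prop := fun L e =>
    v ∈ (e : Sym2 V) ∧ (e : Sym2 V) ∈ greedyAccepted (outside χ i) (sampledList o L) with hhit
  have hcount : ∀ L, (if v ∉ coverOrOutside o L χ i then (freeNeighbors o L v χ i : ℝ) else 0) ≤
      ∑ e : G.edgeSet, if free L e then (1 : ℝ) else 0 := by
    intro L
    by_cases hv : v ∈ coverOrOutside o L χ i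
    · rw [if_neg (not_not.2 hv)]
      exact Finset.sum_nonneg fun _ _ => by split_ifs <;> norm_num
    · rw [if_pos hv, Finset.sum_boole]
      norm_cast
      refine le_trans ?_ (Finset.card_image_le (f := fun e : G.edgeSet => (e : Sym2 V)))
      refine Finset.card_le_card_of_injOn (fun u => s(v, u)) (fun u hu => ?_) fun u _ u' _ h => ?_
      · simp only [Finset.coe_filter, Finset.mem_univ, true_and, Set.mem_ofPred_eq] at hu
        simp only [Finset.coe_image, Finset.coe_filter, Finset.mem_univ, true_and, Set.mem_image,
          Set.mem_ofPred_eq]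
        refine ⟨⟨s(v, u), hu.1⟩, ⟨by simp, fun x hx => ?_⟩, rfl⟩
        rcases Sym2.mem_iff.1 hx with rfl | rfl
        · exact hv
        · exact hu.2
      · exact Sym2.congr_right.1 h
  -- Greedy is maximal, so a sampled edge always has an endpoint that is covered or outside the
  -- part.
  have hnot : ∀ L e, free L e → e ∉ L := by
    rintro L e ⟨-, he⟩ heL
    obtain ⟨x, hx, hxc⟩ := exists_mem_greedyCover (outside χ i) (mem_sampledList ho heL)
    exact he x hx hxc
  have hins : ∀ L e, free L e → hit (insert e L) e := by
    rintro L e he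
    obtain ⟨l₁, l₂, h1, h2⟩ := sampledList_insert ho hn (hnot L e he)
    refine ⟨he.1, ?_⟩
    rw [h2]
    refine mem_greedyAccepted_insert ?_
    rw [← h1]
    exact he.2
  have huniq : ∀ L, ∑ e : G.edgeSet, (if hit L e then (1 : ℝ) else 0) ≤ 1 := by
    intro L
    rw [Finset.sum_boole]
    norm_cast
    rw [Finset.card_le_one]
    intro e he f hf
    simp only [Finset.mem_filter, Finset.mem_univ, true_and] at he hf
    exact Subtype.ext (eq_of_mem_greedyAccepted he.2 hf.2 he.1 hf.1)
  have hp1 := sampleProb_le_one hΔ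
  have hw := sampleWeight_nonneg (G := G) hΔ
  calc sampleProb G * ∑ L, sampleWeight G L *
        (if v ∉ coverOrOutside o L χ i then (freeNeighbors o L v χ i : ℝ) else 0)
      ≤ sampleProb G * ∑ L, sampleWeight G L * ∑ e : G.edgeSet, if free L e then (1 : ℝ) else 0 := by
        refine mul_le_mul_of_nonneg_left ?_ sampleProb_nonneg
        exact Finset.sum_le_sum fun L _ => mul_le_mul_of_nonneg_left (hcount L) (hw L)
    _ = ∑ e : G.edgeSet, ∑ L, if free L e then sampleProb G * sampleWeight G L else 0 := by
        rw [Finset.sum_comm, Finset.mul_sum]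
        refine Finset.sum_congr rfl fun L _ => ?_
        rw [Finset.mul_sum, Finset.mul_sum]
        refine Finset.sum_congr rfl fun e _ => ?_
        split_ifs <;> simp
    _ ≤ ∑ e : G.edgeSet, ∑ L, if hit L e then sampleWeight G L else 0 := by
        refine Finset.sum_le_sum fun e _ => ?_
        rw [← Finset.sum_filter, ← Finset.sum_filter]
        -- For fixed e, inserting e is injective on samples that avoid e, and p·w(L) = (1 - p)·w(L ∪
        -- {e}) ≤ w(L ∪ {e}).
        calc ∑ L with free L e, sampleProb G * sampleWeight G L
            ≤ ∑ L with free L e, sampleWeight G (insert e L) := by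
              refine Finset.sum_le_sum fun L hL => ?_
              rw [Finset.mem_filter] at hL
              rw [← sampleWeight_insert (hnot L e hL.2)]
              have := mul_nonneg (sampleProb_nonneg (G := G)) (hw (insert e L))
              linarith
          _ = ∑ L ∈ (Finset.univ.filter fun L => free L e).image (insert e), sampleWeight G L := by
              rw [Finset.sum_image]
              intro L hL L' hL' h
              simp only [Finset.coe_filter, Finset.mem_univ, true_and, Set.mem_ofPred_eq] at hL hL'
              rw [← Finset.erase_insert (hnot L e hL), h, Finset.erase_insert (hnot L' e hL')]
          _ ≤ ∑ L with hit L e, sampleWeight G L := by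
              refine Finset.sum_le_sum_of_subset_of_nonneg ?_ fun L _ _ => hw L
              intro L hL
              simp only [Finset.mem_image, Finset.mem_filter, Finset.mem_univ, true_and] at hL ⊢
              obtain ⟨L', hL', rfl⟩ := hL
              exact hins L' e hL'
    _ = ∑ L, sampleWeight G L * ∑ e : G.edgeSet, if hit L e then (1 : ℝ) else 0 := by
        rw [Finset.sum_comm]
        refine Finset.sum_congr rfl fun L _ => ?_
        rw [Finset.mul_sum]
        refine Finset.sum_congr rfl fun e _ => ?_
        split_ifs <;> simp
    _ ≤ ∑ L, sampleWeight G L * 1 :=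
        Finset.sum_le_sum fun L _ => mul_le_mul_of_nonneg_left (huniq L) (hw L)
    _ = 1 := by simp [sum_sampleWeight]

end Sampling

/-! ### Expectation over the three random choices -/

section Expectation

open scoped BigOperators

variable {V : Type*} [Fintype V] [DecidableEq V] {G : SimpleGraph V} [DecidableRel G.Adj] {k : ℕ}

lemma mem_edgeOrder (π : G.edgeSet ≃ Fin (Fintype.card G.edgeSet)) (e : G.edgeSet) :
    e ∈ edgeOrder π := by
  rw [edgeOrder, List.mem_ofFn]
  exact ⟨π e, by simp⟩

lemma nodup_edgeOrder (π : G.edgeSet ≃ Fin (Fintype.card G.edgeSet)) : (edgeOrder π).Nodup :=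
  List.nodup_ofFn.2 π.symm.injective

lemma expectation_eq (f : Outcome G k → ℝ) :
    expectation G k f = 𝔼 π, ∑ L, sampleWeight G L * 𝔼 χ, f (π, L, χ) := by
  unfold expectation weight
  rw [Fintype.sum_prod_type, Fintype.expect_eq_sum_div_card, Finset.sum_div,
    Fintype.card_equiv (Fintype.equivFin G.edgeSet)]
  refine Finset.sum_congr rfl fun π _ => ?_
  rw [Fintype.sum_prod_type, Finset.sum_div]
  refine Finset.sum_congr rfl fun L _ => ?_
  rw [Fintype.expect_eq_sum_div_card]
  dsimp only
  rw [← Finset.mul_sum]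
  simp only [Finset.prod_const, Fintype.card_fun, Fintype.card_fin, Finset.card_univ,
    Nat.cast_pow, one_div, inv_pow]
  ring

lemma weight_nonneg (hΔ : 1 ≤ G.maxDegree) (ω : Outcome G k) : 0 ≤ weight G k ω := by
  unfold weight
  have := sampleWeight_nonneg hΔ ω.2.1
  positivity

lemma expectation_mono (hΔ : 1 ≤ G.maxDegree) {f g : Outcome G k → ℝ} (h : ∀ ω, f ω ≤ g ω) :
    expectation G k f ≤ expectation G k g :=
  Finset.sum_le_sum fun ω _ => mul_le_mul_of_nonneg_left (h ω) (weight_nonneg hΔ ω)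

lemma expectation_add (f g : Outcome G k → ℝ) :
    expectation G k (fun ω => f ω + g ω) = expectation G k f + expectation G k g := by
  simp [expectation, mul_add, Finset.sum_add_distrib]

lemma expectation_mul_left (a : ℝ) (f : Outcome G k → ℝ) :
    expectation G k (fun ω => a * f ω) = a * expectation G k f := by
  simp only [expectation, Finset.mul_sum]
  exact Finset.sum_congr rfl fun ω _ => by ring

lemma expectation_sum {ι : Type*} (s : Finset ι) (f : ι → Outcome G k → ℝ) :
    expectation G k (fun ω => ∑ a ∈ s, f a ω) = ∑ a ∈ s, expectation G k (f a) := by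
  simp only [expectation, Finset.mul_sum]
  exact Finset.sum_comm

lemma expectation_one (hk : 1 ≤ k) : expectation G k (fun _ => 1) = 1 := by
  have : Nonempty (Fin k) := ⟨⟨0, hk⟩⟩
  have : Nonempty (G.edgeSet ≃ Fin (Fintype.card G.edgeSet)) := ⟨Fintype.equivFin _⟩
  rw [expectation_eq]
  simp [sum_sampleWeight]

/-- The Markov inequality for the complementary event. -/
lemma one_sub_expectation_le_prob (hΔ : 1 ≤ G.maxDegree) (hk : 1 ≤ k) {A : Outcome G k → Prop}
    (g : Outcome G k → ℝ) (h0 : ∀ ω, 0 ≤ g ω) (h1 : ∀ ω, ¬ A ω → 1 ≤ g ω) :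
    1 - expectation G k g ≤ prob G k A := by
  classical
  have hA : prob G k A = expectation G k fun ω => if A ω then 1 else 0 := by
    simp [prob, expectation]
  have h2 : expectation G k (fun _ => 1) ≤ expectation G k fun ω => (if A ω then 1 else 0) + g ω :=
    expectation_mono hΔ fun ω => ?_
  · rw [expectation_add, expectation_one hk] at h2
    rw [hA]
    linarith
  split_ifs with h
  · linarith [h0 ω]
  · linarith [h1 ω h]

end Expectation

/-! ### Vertices of high residual degree -/

section ResidualDegree

open scoped BigOperators

variable {V : Type*} [Fintype V] [DecidableEq V] {G : SimpleGraph V} [DecidableRel G.Adj] {k : ℕ}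

/-- A large sum forces each single term to be large, unless the terms vary a lot. -/
lemma one_le_of_lt_sum (Y : Fin k → ℝ) (hY : ∀ i, 0 ≤ Y i) (μ : ℝ) {T : ℝ} (hT : 0 < T)
    (hk : 1 ≤ k) (j : Fin k) (h : T < ∑ i, Y i) :
    1 ≤ 2 * k / T * Y j + 16 * k ^ 2 / T ^ 2 * ∑ i, (Y i - μ) ^ 2 := by
  have hk1 : (1 : ℝ) ≤ k := by exact_mod_cast hk
  have hk0 : (0 : ℝ) < k := by linarith
  have hS : 0 ≤ ∑ i, (Y i - μ) ^ 2 := Finset.sum_nonneg fun _ _ => sq_nonneg _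
  by_cases h1 : T / (2 * k) ≤ Y j
  · have : 1 ≤ 2 * k / T * Y j := by
      calc 1 = 2 * k / T * (T / (2 * k)) := by field_simp
        _ ≤ _ := by gcongr
    have h2 : 0 ≤ 16 * (k : ℝ) ^ 2 / T ^ 2 * ∑ i, (Y i - μ) ^ 2 := by positivity
    linarith
  · push Not at h1
    have h3 : T ^ 2 / (16 * k ^ 2) ≤ ∑ i, (Y i - μ) ^ 2 := by
      -- The cut 3T/(4k) lies midway between T/(2k), which exceeds Y j, and T/k, which the average
      -- of the Y i exceeds. Above it Y j alone deviates by T/(4k); below it the deviations sum to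
      -- at least T/4 and Cauchy–Schwarz applies.
      by_cases h2 : 3 * T / (4 * k) ≤ μ
      · have h4 : T / (4 * k) ≤ μ - Y j := by
          have : 3 * T / (4 * k) - T / (2 * k) = T / (4 * (k : ℝ)) := by field_simp; norm_num
          linarith
        calc T ^ 2 / (16 * (k : ℝ) ^ 2) = (T / (4 * k)) ^ 2 := by field_simp; norm_num
          _ ≤ (μ - Y j) ^ 2 := by gcongr
          _ = (Y j - μ) ^ 2 := by ring
          _ ≤ _ := Finset.single_le_sum (f := fun i => (Y i - μ) ^ 2)
            (fun i _ => sq_nonneg _) (Finset.mem_univ j)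
      · push Not at h2
        have h4 : T / 4 ≤ ∑ i, (Y i - μ) := by
          rw [Finset.sum_sub_distrib]
          simp only [Finset.sum_const, Finset.card_univ, Fintype.card_fin, nsmul_eq_mul]
          have : (k : ℝ) * μ ≤ k * (3 * T / (4 * k)) := by gcongr
          have h5 : (k : ℝ) * (3 * T / (4 * k)) = 3 * T / 4 := by field_simp
          linarith
        have h6 := sq_sum_le_card_mul_sum_sq (s := Finset.univ) (f := fun i => Y i - μ)
        simp only [Finset.card_univ, Fintype.card_fin] at h6
        have h7 : (T / 4) ^ 2 ≤ (∑ i, (Y i - μ)) ^ 2 := by gcongr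
        rw [div_le_iff₀ (by positivity)]
        nlinarith [mul_nonneg hS (mul_nonneg hk0.le (sub_nonneg.2 hk1))]
    have h5 : 1 ≤ 16 * k ^ 2 / T ^ 2 * ∑ i, (Y i - μ) ^ 2 := by
      calc 1 = 16 * k ^ 2 / T ^ 2 * (T ^ 2 / (16 * (k : ℝ) ^ 2)) := by field_simp
        _ ≤ _ := by gcongr
    have h6 : 0 ≤ 2 * k / T * Y j := mul_nonneg (by positivity) (hY j)
    linarith

lemma outside_update (χ : V → Fin k) (i : Fin k) (w : V) (j : Fin k) :
    DifferAtMostOne (outside χ i) (outside (Function.update χ w j) i) :=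
  ⟨w, fun y hy => by simp [outside, hy]⟩

lemma cast_freeNeighbors (o : List G.edgeSet) (L : Finset G.edgeSet) (v : V) (χ : V → Fin k)
    (i : Fin k) : (freeNeighbors o L v χ i : ℝ) =
      ∑ u, if G.Adj v u ∧ u ∉ coverOrOutside o L χ i then (1 : ℝ) else 0 := by
  rw [Finset.sum_boole, freeNeighbors]

/-- At most one vertex x changes status, so each count changes by at most 1, and only at neighbours
of x. -/
lemma sum_sq_freeNeighbors_sub_update_le (o : List G.edgeSet) (L : Finset G.edgeSet) (i : Fin k)
    (χ : V → Fin k) (w : V) (j : Fin k) :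
    ∑ v, ((freeNeighbors o L v χ i : ℝ) -
      freeNeighbors o L v (Function.update χ w j) i) ^ 2 ≤ G.maxDegree := by
  obtain ⟨x, hx⟩ := (outside_update χ i w j).greedyCover (sampledList o L)
  change ∀ y, y ≠ x → (y ∈ coverOrOutside o L χ i ↔
    y ∈ coverOrOutside o L (Function.update χ w j) i) at hx
  calc ∑ v, ((freeNeighbors o L v χ i : ℝ) -
        freeNeighbors o L v (Function.update χ w j) i) ^ 2
      ≤ ∑ v, if G.Adj x v then (1 : ℝ) else 0 := by
        refine Finset.sum_le_sum fun v _ => ?_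
        rw [cast_freeNeighbors, cast_freeNeighbors, ← Finset.sum_sub_distrib,
          Finset.sum_eq_single x (fun y _ hy => by simp [hx y hy]) (by simp)]
        have := G.adj_comm x v
        split_ifs <;> first | tauto | norm_num
    _ = G.degree x := by
        rw [Finset.sum_boole, ← SimpleGraph.card_neighborFinset_eq_degree,
          SimpleGraph.neighborFinset_eq_filter]
    _ ≤ G.maxDegree := by exact_mod_cast G.degree_le_maxDegree x

/-- Swapping the labels i and j preserves the uniform distribution of the partition. Since π and L
are fixed, the mean does not depend on the part. -/
lemma expect_freeNeighbors_eq (o : List G.edgeSet) (L : Finset G.edgeSet) (v : V) (i j : Fin k) :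
    𝔼 χ : V → Fin k, (freeNeighbors o L v χ i : ℝ) =
      𝔼 χ : V → Fin k, (freeNeighbors o L v χ j : ℝ) := by
  refine Fintype.expect_equiv (Equiv.arrowCongr (Equiv.refl V) (Equiv.swap i j)) _ _ fun χ => ?_
  have : outside χ i =
      outside (Equiv.arrowCongr (Equiv.refl V) (Equiv.swap i j) χ) j := by
    ext u
    simp [outside, Equiv.swap_apply_eq_iff]
  unfold freeNeighbors coverOrOutside
  rw [this]

lemma expect_sum_sq_freeNeighbors_sub_le (o : List G.edgeSet) (L : Finset G.edgeSet)
    (i₀ : Fin k) :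
    𝔼 χ : V → Fin k, ∑ v, ∑ i, ((freeNeighbors o L v χ i : ℝ) -
      𝔼 χ' : V → Fin k, (freeNeighbors o L v χ' i₀ : ℝ)) ^ 2 ≤
        k * (Fintype.card V * G.maxDegree) := by
  have : Nonempty (Fin k) := ⟨i₀⟩
  have h1 : ∀ χ : V → Fin k, ∑ v, ∑ i, ((freeNeighbors o L v χ i : ℝ) -
      𝔼 χ' : V → Fin k, (freeNeighbors o L v χ' i₀ : ℝ)) ^ 2 =
      ∑ i, ∑ v, ((freeNeighbors o L v χ i : ℝ) -
        𝔼 χ' : V → Fin k, (freeNeighbors o L v χ' i : ℝ)) ^ 2 := by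
    intro χ
    rw [Finset.sum_comm]
    refine Finset.sum_congr rfl fun i _ => Finset.sum_congr rfl fun v _ => ?_
    rw [expect_freeNeighbors_eq o L v i₀ i]
  simp_rw [h1, Finset.expect_sum_comm]
  calc _ ≤ ∑ _i : Fin k, ((Fintype.card V : ℝ) * G.maxDegree) :=
        Finset.sum_le_sum fun i _ =>
          sum_variance_le (fun v (χ : V → Fin k) => (freeNeighbors o L v χ i : ℝ)) _
            fun χ w j => sum_sq_freeNeighbors_sub_update_le o L i χ w j
    _ = _ := by simp

/-- With π and χ held fixed, the part of v is a fixed index, and the insertion argument over L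
applies. -/
lemma expectation_own_freeNeighbors_le (hΔ : 1 ≤ G.maxDegree) (hk : 1 ≤ k) (v : V) :
    expectation G k (fun ω =>
      if v ∉ coverOrOutside (edgeOrder ω.1) ω.2.1 ω.2.2 (ω.2.2 v) then
        (freeNeighbors (edgeOrder ω.1) ω.2.1 v ω.2.2 (ω.2.2 v) : ℝ) else 0) ≤
      1 / sampleProb G := by
  have : Nonempty (Fin k) := ⟨⟨0, hk⟩⟩
  have : Nonempty (G.edgeSet ≃ Fin (Fintype.card G.edgeSet)) := ⟨Fintype.equivFin _⟩
  rw [expectation_eq]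
  refine Finset.expect_le Finset.univ_nonempty fun π _ => ?_
  simp_rw [Finset.mul_expect]
  rw [← Finset.expect_sum_comm]
  refine Finset.expect_le Finset.univ_nonempty fun χ _ => ?_
  rw [le_div_iff₀' (sampleProb_pos hΔ)]
  exact sampleProb_mul_expected_freeNeighbors_le hΔ (mem_edgeOrder π) (nodup_edgeOrder π) χ _ v

theorem expectation_highResDegreeCount_le (hΔ : 1 ≤ G.maxDegree) (hk : 1 ≤ k) {T : ℝ}
    (hT : T = (G.maxDegree : ℝ) ^ (0.99 : ℝ)) :
    expectation G k (fun ω => (highResDegreeCount ω : ℝ)) ≤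
      2 * k / T * (Fintype.card V * (1 / sampleProb G)) +
        16 * k ^ 2 / T ^ 2 * (k * (Fintype.card V * G.maxDegree)) := by
  classical
  have : Nonempty (Fin k) := ⟨⟨0, hk⟩⟩
  have : Nonempty (G.edgeSet ≃ Fin (Fintype.card G.edgeSet)) := ⟨Fintype.equivFin _⟩
  have hT0 : 0 < T := by
    rw [hT]
    exact Real.rpow_pos_of_pos (by exact_mod_cast hΔ) _
  set i₀ : Fin k := ⟨0, hk⟩
  set own : Outcome G k → V → ℝ := fun ω v =>
    if v ∉ coverOrOutside (edgeOrder ω.1) ω.2.1 ω.2.2 (ω.2.2 v) then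
      (freeNeighbors (edgeOrder ω.1) ω.2.1 v ω.2.2 (ω.2.2 v) : ℝ) else 0 with hown
  set dev : Outcome G k → V → ℝ := fun ω v =>
    ∑ i, ((freeNeighbors (edgeOrder ω.1) ω.2.1 v ω.2.2 i : ℝ) -
      𝔼 χ' : V → Fin k, (freeNeighbors (edgeOrder ω.1) ω.2.1 v χ' i₀ : ℝ)) ^ 2 with hdev
  have hdev0 : ∀ ω v, 0 ≤ dev ω v := fun ω v => Finset.sum_nonneg fun _ _ => sq_nonneg _
  have hown0 : ∀ ω v, 0 ≤ own ω v := fun ω v => by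
    simp only [hown]; split_ifs <;> positivity
  have hpt : ∀ ω : Outcome G k, (highResDegreeCount ω : ℝ) ≤
      2 * k / T * ∑ v, own ω v + 16 * k ^ 2 / T ^ 2 * ∑ v, dev ω v := by
    intro ω
    rw [highResDegreeCount, ← Finset.sum_boole, Finset.mul_sum, Finset.mul_sum,
      ← Finset.sum_add_distrib]
    refine Finset.sum_le_sum fun v _ => ?_
    split_ifs with h
    · rw [← hT] at h
      have hpos : 0 < resDegree G (outputMatching ω) v := by
        have := hT0.trans h
        exact_mod_cast this
      have hv := notMem_coverOrOutside_of_resDegree_pos ω hpos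
      have hle : (resDegree G (outputMatching ω) v : ℝ) ≤
          ∑ i, (freeNeighbors (edgeOrder ω.1) ω.2.1 v ω.2.2 i : ℝ) := by
        exact_mod_cast resDegree_outputMatching_le ω v
      simp only [hown, if_pos hv]
      exact one_le_of_lt_sum _ (fun i => Nat.cast_nonneg _) _ hT0 hk _ (h.trans_le hle)
    · have := hdev0 ω v
      have := hown0 ω v
      positivity
  refine (expectation_mono hΔ hpt).trans ?_
  rw [expectation_add, expectation_mul_left, expectation_mul_left]
  gcongr
  · rw [expectation_sum]
    refine (Finset.sum_le_sum fun v _ => expectation_own_freeNeighbors_le hΔ hk v).trans ?_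
    simp
  · rw [expectation_eq]
    refine Finset.expect_le Finset.univ_nonempty fun π _ => ?_
    calc _ ≤ ∑ L, sampleWeight G L * (k * (Fintype.card V * G.maxDegree)) :=
          Finset.sum_le_sum fun L _ => mul_le_mul_of_nonneg_left
            (expect_sum_sq_freeNeighbors_sub_le (edgeOrder π) L i₀) (sampleWeight_nonneg hΔ L)
      _ = _ := by rw [← Finset.sum_mul, sum_sampleWeight, one_mul]

end ResidualDegree

/-! ### Space as a function of vertex and edge counts -/

section Space

open scoped BigOperators

variable {V : Type*} [Fintype V] [DecidableEq V] {G : SimpleGraph V} [DecidableRel G.Adj] {k : ℕ}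

lemma card_partMatching_le (ω : Outcome G k) (i : Fin k) :
    (partMatching ω i).card ≤ (partEdges ω i).card := by
  classical
  refine (card_greedyMatching_le _).trans ?_
  rw [orderedPartEdges, List.length_map]
  have hn : ((List.ofFn fun j => ω.1.symm j).filter fun e => e ∈ partEdges ω i).Nodup :=
    (nodup_edgeOrder ω.1).filter _
  rw [← List.toFinset_card_of_nodup hn]
  refine Finset.card_le_card fun e he => ?_
  simp only [List.mem_toFinset, List.mem_filter, decide_eq_true_eq] at he
  exact he.2

/-- An edge costs 3 words with its rank, and at most 2 more if it is matched. -/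
lemma machineSpace_le (ω : Outcome G k) (i : Fin k) :
    machineSpace ω i ≤ (partVerts ω i).card + 5 * (partEdges ω i).card := by
  have h : machineSpace ω i =
      (partVerts ω i).card + 3 * (partEdges ω i).card + 2 * (partMatching ω i).card := by
    simp [machineSpace, machineMemory, received, wordsOf, Function.comp_def, Datum.words, mul_comm]
  have := card_partMatching_le ω i
  omega

lemma sum_card_partVerts (ω : Outcome G k) : ∑ i, (partVerts ω i).card = Fintype.card V := by
  unfold partVerts
  rw [← Finset.card_eq_sum_card_fiberwise (f := ω.2.2) (s := Finset.univ) (t := Finset.univ)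
    (by simp)]
  simp

lemma sum_card_partEdges_le (ω : Outcome G k) : ∑ i, (partEdges ω i).card ≤ ω.2.1.card := by
  classical
  rw [← Finset.card_biUnion]
  · refine Finset.card_le_card fun e he => ?_
    simp only [Finset.mem_biUnion, partEdges, Finset.mem_filter] at he
    obtain ⟨_, _, h, _⟩ := he
    exact h
  · intro i _ j _ hij
    rw [Function.onFun, Finset.disjoint_left]
    intro e hi hj
    simp only [partEdges, Finset.mem_filter] at hi hj
    have h := (e : Sym2 V).out_fst_mem
    exact hij ((hi.2 _ h).symm.trans (hj.2 _ h))

lemma totalSpace_le (ω : Outcome G k) :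
    totalSpace ω ≤ 3 * Fintype.card V + 8 * ω.2.1.card := by
  have h1 : wordsOf (randomizationData ω) = 2 * Fintype.card V + 3 * ω.2.1.card := by
    simp [randomizationData, wordsOf, Function.comp_def, Datum.words, mul_comm]
  have h2 : ∑ i, machineSpace ω i ≤
      ∑ i, ((partVerts ω i).card + 5 * (partEdges ω i).card) :=
    Finset.sum_le_sum fun i _ => machineSpace_le ω i
  rw [Finset.sum_add_distrib, ← Finset.mul_sum, sum_card_partVerts] at h2
  have h3 := sum_card_partEdges_le ω
  unfold totalSpace
  omega

lemma card_edges_at_le (w : V) :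
    (Finset.univ.filter fun e : G.edgeSet => w ∈ (e : Sym2 V)).card ≤ G.maxDegree := by
  refine le_trans ?_ (G.degree_le_maxDegree w)
  rw [← G.card_incidenceFinset_eq_degree]
  refine Finset.card_le_card_of_injOn (fun e => (e : Sym2 V)) (fun e he => ?_)
    fun e _ f _ h => Subtype.ext h
  simp only [Finset.coe_filter, Finset.mem_univ, true_and, Set.mem_ofPred_eq] at he
  simpa [SimpleGraph.incidenceSet] using he

/-- The polynomial `s ∑ x_v + a ∑ x_u x_v` of a graph, the second sum being over the edges. -/
def edgePoly (G : SimpleGraph V) [DecidableRel G.Adj] (s a : ℝ) (x : V → ℝ) : ℝ :=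
  s * ∑ v, x v + a * ∑ e : G.edgeSet, ∏ v ∈ (e : Sym2 V).toFinset, x v

lemma edgePoly_const (s a t : ℝ) :
    edgePoly G s a (fun _ => t) = s * (Fintype.card V * t) + a * (G.edgeFinset.card * t ^ 2) := by
  have h : ∀ e : G.edgeSet, (e : Sym2 V).toFinset.card = 2 := fun e =>
    Sym2.card_toFinset_of_not_isDiag _ (G.not_isDiag_of_mem_edgeSet e.2)
  rw [SimpleGraph.edgeFinset_card]
  simp [edgePoly, h]

/-- The derivative in x_w is s plus a times the sum of the other endpoints' values over the at most
Δ edges at w. -/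
lemma edgePoly_update {s a : ℝ} (hs : 0 ≤ s) (ha : 0 ≤ a) (h : s + a * G.maxDegree ≤ 1)
    (x : V → ℝ) (h0 : ∀ v, 0 ≤ x v) (h1 : ∀ v, x v ≤ 1) (w : V) :
    ∃ D, 0 ≤ D ∧ D ≤ 1 ∧ ∀ t, edgePoly G s a (Function.update x w t) =
      edgePoly G s a (Function.update x w 0) + t * D := by
  set c : G.edgeSet → ℝ := fun e =>
    if w ∈ (e : Sym2 V) then ∏ v ∈ (e : Sym2 V).toFinset \ {w}, x v else 0 with hc
  have hc0 : ∀ e, 0 ≤ c e := fun e => by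
    simp only [hc]
    split_ifs
    · exact Finset.prod_nonneg fun v _ => h0 v
    · exact le_rfl
  refine ⟨s + a * ∑ e, c e, ?_, ?_, fun t => ?_⟩
  · have := Finset.sum_nonneg fun e (_ : e ∈ Finset.univ) => hc0 e
    positivity
  · refine le_trans ?_ h
    gcongr
    calc ∑ e, c e ≤ ∑ e : G.edgeSet, if w ∈ (e : Sym2 V) then (1 : ℝ) else 0 := by
          refine Finset.sum_le_sum fun e _ => ?_
          simp only [hc]
          split_ifs
          · exact Finset.prod_le_one (fun v _ => h0 v) fun v _ => h1 v
          · exact le_rfl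
      _ ≤ G.maxDegree := by
          rw [Finset.sum_boole]
          exact_mod_cast card_edges_at_le w
  · have hv : ∀ t, ∑ v, Function.update x w t v = t + ∑ v ∈ Finset.univ \ {w}, x v := fun t =>
      Finset.sum_update_of_mem (Finset.mem_univ w) x t
    have he : ∀ t, ∀ e : G.edgeSet, ∏ v ∈ (e : Sym2 V).toFinset, Function.update x w t v =
        ∏ v ∈ (e : Sym2 V).toFinset, Function.update x w 0 v + t * c e := by
      intro t e
      simp only [hc]
      by_cases hw : w ∈ (e : Sym2 V)
      · have hw' : w ∈ (e : Sym2 V).toFinset := by simpa using hw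
        rw [Finset.prod_update_of_mem hw', Finset.prod_update_of_mem hw', if_pos hw]
        ring
      · have hw' : w ∉ (e : Sym2 V).toFinset := by simpa using hw
        rw [Finset.prod_update_of_notMem hw', Finset.prod_update_of_notMem hw', if_neg hw]
        ring
    unfold edgePoly
    rw [hv, hv, Finset.sum_congr rfl fun e _ => he t e, Finset.sum_add_distrib, ← Finset.mul_sum]
    ring

/-- Exponential moment of the space of one machine. -/
lemma expectation_exp_machineSpace_le (hΔ : 1 ≤ G.maxDegree) (hk : 2 ≤ k) (i : Fin k) {s : ℝ}
    (hs : 0 ≤ s) (hs5 : 5 * s ≤ 1) (hsΔ : s + 10 * sampleProb G * s * G.maxDegree ≤ 1) :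
    expectation G k (fun ω => Real.exp (s * machineSpace ω i)) ≤
      Real.exp (s * (2 * Fintype.card V / k +
        40 * sampleProb G * G.edgeFinset.card / k ^ 2)) := by
  classical
  have : Nonempty (Fin k) := ⟨i⟩
  have : Nonempty (G.edgeSet ≃ Fin (Fintype.card G.edgeSet)) := ⟨Fintype.equivFin _⟩
  have hp := sampleProb_nonneg (G := G)
  have hk2 : (2 : ℝ) ≤ k := by exact_mod_cast hk
  set z : (V → Fin k) → G.edgeSet → ℝ := fun χ e =>
    5 * s * ∏ v ∈ (e : Sym2 V).toFinset, if χ v = i then 1 else 0 with hz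
  have hprod : ∀ (χ : V → Fin k) (e : G.edgeSet),
      ∏ v ∈ (e : Sym2 V).toFinset, (if χ v = i then (1 : ℝ) else 0) =
        if ∀ v ∈ (e : Sym2 V), χ v = i then 1 else 0 := by
    intro χ e
    rw [Finset.prod_boole]
    simp
  have hz0 : ∀ χ e, 0 ≤ z χ e := fun χ e => by
    simp only [hz, hprod]; split_ifs <;> simp [hs]
  have hz1 : ∀ χ e, z χ e ≤ 1 := fun χ e => by
    simp only [hz, hprod]; split_ifs <;> simp [hs5]
  have hpt : ∀ ω : Outcome G k, Real.exp (s * machineSpace ω i) ≤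
      Real.exp (s * ∑ v, if ω.2.2 v = i then 1 else 0) * Real.exp (∑ e ∈ ω.2.1, z ω.2.2 e) := by
    intro ω
    rw [← Real.exp_add, Real.exp_le_exp]
    have h1 : (machineSpace ω i : ℝ) ≤ (partVerts ω i).card + 5 * (partEdges ω i).card := by
      exact_mod_cast machineSpace_le ω i
    have h2 : ∑ e ∈ ω.2.1, z ω.2.2 e = 5 * s * (partEdges ω i).card := by
      simp only [hz, hprod, ← Finset.mul_sum, Finset.sum_boole, partEdges]
    have h3 : ∑ v, (if ω.2.2 v = i then (1 : ℝ) else 0) = (partVerts ω i).card := by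
      rw [Finset.sum_boole, partVerts]
    rw [h2, h3]
    linarith [mul_le_mul_of_nonneg_left h1 hs]
  refine (expectation_mono hΔ hpt).trans ?_
  rw [expectation_eq]
  refine Finset.expect_le Finset.univ_nonempty fun π _ => ?_
  simp_rw [Finset.mul_expect]
  rw [← Finset.expect_sum_comm]
  -- The edge coefficient 10ps is the weight 5s of an edge times the factor 2p produced by averaging
  -- over L.
  calc _ ≤ 𝔼 χ : V → Fin k, Real.exp (edgePoly G s (10 * sampleProb G * s)
        fun v => if χ v = i then 1 else 0) := by
        refine Finset.expect_le_expect fun χ _ => ?_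
        have h1 := sum_sampleWeight_mul_exp_le hΔ (z χ) (hz0 χ) (hz1 χ)
        calc _ = Real.exp (s * ∑ v, if χ v = i then 1 else 0) *
              ∑ L, sampleWeight G L * Real.exp (∑ e ∈ L, z χ e) := by
              rw [Finset.mul_sum]
              exact Finset.sum_congr rfl fun L _ => by ring
          _ ≤ Real.exp (s * ∑ v, if χ v = i then 1 else 0) *
              Real.exp (2 * sampleProb G * ∑ e, z χ e) := by gcongr
          _ = _ := by
              rw [← Real.exp_add, edgePoly]
              simp only [hz, ← Finset.mul_sum]
              ring_nf
    _ ≤ Real.exp (edgePoly G s (10 * sampleProb G * s) fun _ => 2 * (1 / (k : ℝ))) := by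
        refine expect_exp_le _ i (by simp) ?_ fun x h0 h1 w =>
          edgePoly_update hs (by positivity) hsΔ x h0 h1 w
        rw [mul_one_div, div_le_one (by linarith)]
        exact hk2
    _ = _ := by
        rw [edgePoly_const]
        congr 1
        field_simp
        ring

/-- Exponential moment of the number of sampled edges. -/
lemma expectation_exp_card_sample_le (hΔ : 1 ≤ G.maxDegree) (hk : 1 ≤ k) :
    expectation G k (fun ω => Real.exp (ω.2.1.card : ℝ)) ≤
      Real.exp (2 * sampleProb G * G.edgeFinset.card) := by
  have : Nonempty (Fin k) := ⟨⟨0, hk⟩⟩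
  have : Nonempty (G.edgeSet ≃ Fin (Fintype.card G.edgeSet)) := ⟨Fintype.equivFin _⟩
  rw [expectation_eq, SimpleGraph.edgeFinset_card]
  refine Finset.expect_le Finset.univ_nonempty fun π _ => ?_
  have := sum_sampleWeight_mul_exp_le hΔ (fun _ => 1) (by simp) (by simp)
  simpa using this

end Space

/-! ### Choice of exponents and constants -/

section Bounds

variable {V : Type*} [Fintype V] [DecidableEq V] {G : SimpleGraph V} [DecidableRel G.Adj] {k : ℕ}

lemma maxDegree_lt_card (hΔ : 1 ≤ G.maxDegree) : G.maxDegree < Fintype.card V := by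
  rcases isEmpty_or_nonempty V with h | h
  · have : G.maxDegree = 0 := by simp [SimpleGraph.maxDegree]
    omega
  · exact G.maxDegree_lt_card_verts

lemma two_mul_card_edgeFinset_le :
    2 * (G.edgeFinset.card : ℝ) ≤ Fintype.card V * G.maxDegree := by
  have h : 2 * G.edgeFinset.card ≤ Fintype.card V * G.maxDegree := by
    rw [← G.sum_degrees_eq_twice_card_edges]
    calc ∑ v, G.degree v ≤ ∑ _v : V, G.maxDegree :=
          Finset.sum_le_sum fun v _ => G.degree_le_maxDegree v
      _ = _ := by simp
  exact_mod_cast h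

lemma parts_bounds {d : ℝ} (hd : 1 ≤ d) (hk : |(k : ℝ) - d ^ (0.1 : ℝ)| < 1) :
    1 ≤ k ∧ d ^ (0.1 : ℝ) / 2 ≤ k ∧ (k : ℝ) ≤ 2 * d ^ (0.1 : ℝ) := by
  have h1 : 1 ≤ d ^ (0.1 : ℝ) := Real.one_le_rpow hd (by norm_num)
  rw [abs_lt] at hk
  have h2 : 1 ≤ k := by
    have : (0 : ℝ) < k := by linarith
    exact_mod_cast this
  have h3 : (1 : ℝ) ≤ k := by exact_mod_cast h2
  exact ⟨h2, by linarith, by linarith⟩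

/-- With k ≤ 2Δ^0.1 the own-part term is 4nΔ^(-0.04) and the variance term is 128nΔ^(-0.68). -/
theorem expectation_highResDegreeCount_le_rpow (hΔ : 1 ≤ G.maxDegree)
    (hk : |(k : ℝ) - (G.maxDegree : ℝ) ^ (0.1 : ℝ)| < 1) :
    expectation G k (fun ω => (highResDegreeCount ω : ℝ)) ≤
      132 * ((Fintype.card V : ℝ) / (G.maxDegree : ℝ) ^ (0.03 : ℝ)) := by
  set d : ℝ := (G.maxDegree : ℝ) with hd
  set n : ℝ := (Fintype.card V : ℝ) with hn
  have hn0 : 0 ≤ n := Nat.cast_nonneg _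
  have hd1 : 1 ≤ d := by rw [hd]; exact_mod_cast hΔ
  have hd0 : 0 < d := by linarith
  obtain ⟨hk1, -, hk2⟩ := parts_bounds hd1 hk
  refine (expectation_highResDegreeCount_le hΔ hk1 rfl).trans ?_
  rw [← hd, ← hn, sampleProb, ← hd]
  have e1 : 2 * (2 * d ^ (0.1 : ℝ)) / d ^ (0.99 : ℝ) * (n * (1 / d ^ (-0.85 : ℝ))) =
      4 * n * d ^ (-0.04 : ℝ) := by
    have : d ^ (-0.04 : ℝ) = d ^ (0.1 : ℝ) / d ^ (0.99 : ℝ) / d ^ (-0.85 : ℝ) := by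
      rw [← Real.rpow_sub hd0, ← Real.rpow_sub hd0]; norm_num
    rw [this]; ring
  have e2 : 16 * (2 * d ^ (0.1 : ℝ)) ^ 2 / (d ^ (0.99 : ℝ)) ^ 2 *
      ((2 * d ^ (0.1 : ℝ)) * (n * d)) = 128 * n * d ^ (-0.68 : ℝ) := by
    have : d ^ (-0.68 : ℝ) = (d ^ (0.1 : ℝ)) ^ 3 * d / (d ^ (0.99 : ℝ)) ^ 2 := by
      rw [← Real.rpow_natCast (d ^ (0.1 : ℝ)) 3, ← Real.rpow_natCast (d ^ (0.99 : ℝ)) 2,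
        ← Real.rpow_mul hd0.le, ← Real.rpow_mul hd0.le, ← Real.rpow_add_one hd0.ne',
        ← Real.rpow_sub hd0]
      norm_num
    rw [this]; ring
  have h1 : d ^ (-0.04 : ℝ) ≤ d ^ (-0.03 : ℝ) := Real.rpow_le_rpow_of_exponent_le hd1 (by norm_num)
  have h2 : d ^ (-0.68 : ℝ) ≤ d ^ (-0.03 : ℝ) := Real.rpow_le_rpow_of_exponent_le hd1 (by norm_num)
  calc 2 * (k : ℝ) / d ^ (0.99 : ℝ) * (n * (1 / d ^ (-0.85 : ℝ))) +
        16 * (k : ℝ) ^ 2 / (d ^ (0.99 : ℝ)) ^ 2 * (k * (n * d))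
      ≤ 2 * (2 * d ^ (0.1 : ℝ)) / d ^ (0.99 : ℝ) * (n * (1 / d ^ (-0.85 : ℝ))) +
        16 * (2 * d ^ (0.1 : ℝ)) ^ 2 / (d ^ (0.99 : ℝ)) ^ 2 *
          ((2 * d ^ (0.1 : ℝ)) * (n * d)) := by gcongr
    _ = 4 * n * d ^ (-0.04 : ℝ) + 128 * n * d ^ (-0.68 : ℝ) := by rw [e1, e2]
    _ ≤ 4 * n * d ^ (-0.03 : ℝ) + 128 * n * d ^ (-0.03 : ℝ) := by gcongr
    _ = 132 * (n / d ^ (0.03 : ℝ)) := by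
        rw [Real.rpow_neg hd0.le]; ring

theorem totalSpace_bound (hΔ : 1 ≤ G.maxDegree) (hk : 1 ≤ k) :
    1 - Real.exp (-((Fintype.card V : ℝ) ^ (0.01 : ℝ))) ≤
      prob G k fun ω => (totalSpace ω : ℝ) ≤ 3000 * (Fintype.card V : ℝ) +
        (G.edgeFinset.card : ℝ) / (G.maxDegree : ℝ) ^ (0.01 : ℝ) := by
  set d : ℝ := (G.maxDegree : ℝ) with hd
  set n : ℝ := (Fintype.card V : ℝ) with hn
  set m : ℝ := (G.edgeFinset.card : ℝ) with hm
  have hd1 : 1 ≤ d := by rw [hd]; exact_mod_cast hΔ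
  have hd0 : 0 < d := by linarith
  have hn1 : 1 ≤ n := by
    have := maxDegree_lt_card hΔ
    rw [hn]
    exact_mod_cast (by omega : 1 ≤ Fintype.card V)
  have hm0 : 0 ≤ m := Nat.cast_nonneg _
  have hmn : 2 * m ≤ n * d := two_mul_card_edgeFinset_le
  -- For Δ ≥ 256 the factor Δ^0.84 absorbs 16. For smaller Δ, m ≤ 128n and 16·128 = 2048. The 16 is
  -- 8 words per sampled edge times the 2 in the exponential moment.
  have hpm : 16 * sampleProb G * m ≤ 2048 * n + m / d ^ (0.01 : ℝ) := by
    by_cases hbig : 256 ≤ d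
    · have h16 : 16 ≤ d ^ (0.84 : ℝ) := by
        calc (16 : ℝ) = 256 ^ (0.5 : ℝ) := by
              rw [show (256 : ℝ) = 16 ^ (2 : ℝ) by norm_num, ← Real.rpow_mul (by norm_num)]
              norm_num
          _ ≤ d ^ (0.5 : ℝ) := by gcongr
          _ ≤ d ^ (0.84 : ℝ) := Real.rpow_le_rpow_of_exponent_le hd1 (by norm_num)
      have h1 : 16 * d ^ (-0.85 : ℝ) ≤ (d ^ (0.01 : ℝ))⁻¹ := by
        calc 16 * d ^ (-0.85 : ℝ) ≤ d ^ (0.84 : ℝ) * d ^ (-0.85 : ℝ) := by gcongr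
          _ = (d ^ (0.01 : ℝ))⁻¹ := by
            rw [← Real.rpow_add hd0, ← Real.rpow_neg hd0.le]; norm_num
      have h2 := mul_le_mul_of_nonneg_right h1 hm0
      rw [sampleProb, ← hd, div_eq_inv_mul]
      linarith
    · push Not at hbig
      have h1 : m ≤ 128 * n := by nlinarith
      have h2 : sampleProb G * m ≤ 1 * m := by
        gcongr
        exact sampleProb_le_one hΔ
      have h3 : 0 ≤ m / d ^ (0.01 : ℝ) := by positivity
      linarith
  refine le_trans ?_ (one_sub_expectation_le_prob hΔ hk
    (fun ω => Real.exp (-(2 * sampleProb G * m + n)) * Real.exp (ω.2.1.card : ℝ))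
    (fun ω => by positivity) fun ω hω => ?_)
  · rw [expectation_mul_left]
    gcongr
    calc _ ≤ Real.exp (-(2 * sampleProb G * m + n)) * Real.exp (2 * sampleProb G * m) := by
          gcongr
          exact expectation_exp_card_sample_le hΔ hk
      _ = Real.exp (-n) := by rw [← Real.exp_add]; congr 1; ring
      _ ≤ _ := by
          rw [Real.exp_le_exp, neg_le_neg_iff]
          calc n ^ (0.01 : ℝ) ≤ n ^ (1 : ℝ) :=
                Real.rpow_le_rpow_of_exponent_le hn1 (by norm_num)
            _ = n := Real.rpow_one n
  · have h1 : (totalSpace ω : ℝ) ≤ 3 * n + 8 * ω.2.1.card := by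
      rw [hn]
      exact_mod_cast totalSpace_le ω
    rw [← Real.exp_add]
    refine Real.one_le_exp ?_
    push Not at hω
    linarith

/-- The numerical inequalities behind the bound on the space of a machine. -/
lemma eventually_machine_bounds : ∀ᶠ x : ℝ in Filter.atTop,
    85 ≤ x ^ (0.04 : ℝ) ∧ 2 ≤ x ^ (0.1 : ℝ) ∧
      2 * x * Real.exp (-(x ^ (0.8 : ℝ) / 11)) ≤ Real.exp (-(x ^ (0.01 : ℝ))) := by
  have h1 := (tendsto_rpow_atTop (show (0 : ℝ) < 0.04 by norm_num)).eventually_ge_atTop 85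
  have h2 := (tendsto_rpow_atTop (show (0 : ℝ) < 0.1 by norm_num)).eventually_ge_atTop 2
  have h3 := (isLittleO_log_rpow_atTop (show (0 : ℝ) < 0.8 by norm_num)).def
    (show (0 : ℝ) < 1 / 44 by norm_num)
  have h4 := (tendsto_rpow_atTop (show (0 : ℝ) < 0.79 by norm_num)).eventually_ge_atTop 44
  filter_upwards [h1, h2, h3, h4, Filter.eventually_ge_atTop 2] with x h1 h2 h3 h4 hx
  refine ⟨h1, h2, ?_⟩
  have hx0 : 0 < x := by linarith
  have hlog0 : 0 ≤ Real.log x := Real.log_nonneg (by linarith)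
  rw [Real.norm_of_nonneg hlog0, Real.norm_of_nonneg (by positivity)] at h3
  have h5 : Real.log 2 ≤ Real.log x := Real.log_le_log (by norm_num) hx
  have h6 : 44 * x ^ (0.01 : ℝ) ≤ x ^ (0.8 : ℝ) := by
    calc 44 * x ^ (0.01 : ℝ) ≤ x ^ (0.79 : ℝ) * x ^ (0.01 : ℝ) := by gcongr
      _ = x ^ (0.8 : ℝ) := by rw [← Real.rpow_add hx0]; norm_num
  have h7 : 2 * x = Real.exp (Real.log 2 + Real.log x) := by
    rw [Real.exp_add, Real.exp_log (by norm_num), Real.exp_log hx0]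
  rw [h7, ← Real.exp_add, Real.exp_le_exp]
  have : 0 ≤ x ^ (0.8 : ℝ) := by positivity
  linarith

/-- The exponential moment behaves as if the mean were at most 84nΔ^(-0.05), of which 4 comes from
vertices and 80 from edges. The threshold 85nΔ^(-0.05) leaves a gap which, scaled by s, is
nΔ^(-0.2)/11 ≥ n^0.8/11 because Δ ≤ n; this beats the union bound over k ≤ 2n machines. -/
theorem machineSpace_bound {Δ₀ : ℝ}
    (hΔ₀ : ∀ x, Δ₀ ≤ x → 85 ≤ x ^ (0.04 : ℝ) ∧ 2 ≤ x ^ (0.1 : ℝ) ∧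
      2 * x * Real.exp (-(x ^ (0.8 : ℝ) / 11)) ≤ Real.exp (-(x ^ (0.01 : ℝ))))
    (hΔ : 1 ≤ G.maxDegree) (hk : |(k : ℝ) - (G.maxDegree : ℝ) ^ (0.1 : ℝ)| < 1)
    (hlarge : Δ₀ ≤ G.maxDegree) :
    1 - Real.exp (-((Fintype.card V : ℝ) ^ (0.01 : ℝ))) ≤
      prob G k fun ω => ∀ i : Fin k,
        (machineSpace ω i : ℝ) ≤ (Fintype.card V : ℝ) / (G.maxDegree : ℝ) ^ (0.01 : ℝ) := by
  set d : ℝ := (G.maxDegree : ℝ) with hd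
  set n : ℝ := (Fintype.card V : ℝ) with hn
  set m : ℝ := (G.edgeFinset.card : ℝ) with hm
  have hd1 : 1 ≤ d := by rw [hd]; exact_mod_cast hΔ
  have hd0 : 0 < d := by linarith
  have hdn : d ≤ n := by
    rw [hd, hn]
    exact_mod_cast (maxDegree_lt_card hΔ).le
  have hn0 : 0 < n := by linarith
  have hm0 : 0 ≤ m := Nat.cast_nonneg _
  have hmn : 2 * m ≤ n * d := two_mul_card_edgeFinset_le
  obtain ⟨h85, htwo, -⟩ := hΔ₀ d hlarge
  obtain ⟨-, -, hexp⟩ := hΔ₀ n (hlarge.trans hdn)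
  obtain ⟨hk1, hkl, hku⟩ := parts_bounds hd1 hk
  have hk2 : 2 ≤ k := by
    have : (1 : ℝ) < k := by
      have := (abs_lt.1 hk).1
      linarith
    exact_mod_cast this
  have hkpos : (0 : ℝ) < k := by exact_mod_cast hk1
  -- Since pΔ = Δ^0.15, the derivative bound s + 10psΔ equals s + 10/11, and s ≤ 1/11.
  set s : ℝ := d ^ (-0.15 : ℝ) / 11 with hs
  have hs0 : 0 < s := by positivity
  have hd15 : d ^ (-0.15 : ℝ) ≤ 1 := Real.rpow_le_one_of_one_le_of_nonpos hd1 (by norm_num)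
  have hsΔ : s + 10 * sampleProb G * s * G.maxDegree ≤ 1 := by
    have : sampleProb G * d ^ (-0.15 : ℝ) * d = 1 := by
      rw [sampleProb, ← hd, ← Real.rpow_add hd0, ← Real.rpow_add_one hd0.ne']
      norm_num
    rw [← hd, hs]
    linarith
  have hmean : 2 * n / k + 40 * sampleProb G * m / k ^ 2 ≤ 84 * n * d ^ (-0.05 : ℝ) := by
    have h1 : 2 * n / k ≤ 4 * n * d ^ (-0.05 : ℝ) := by
      calc 2 * n / k ≤ 2 * n / (d ^ (0.1 : ℝ) / 2) := by gcongr
        _ = 4 * n * d ^ (-0.1 : ℝ) := by rw [Real.rpow_neg hd0.le]; field_simp; norm_num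
        _ ≤ 4 * n * d ^ (-0.05 : ℝ) := by
          gcongr
          norm_num
    have h2 : 40 * sampleProb G * m / k ^ 2 ≤ 80 * n * d ^ (-0.05 : ℝ) := by
      have e : d ^ (-0.05 : ℝ) = d ^ (-0.85 : ℝ) * d / (d ^ (0.1 : ℝ)) ^ 2 := by
        rw [← Real.rpow_natCast (d ^ (0.1 : ℝ)) 2, ← Real.rpow_mul hd0.le,
          ← Real.rpow_add_one hd0.ne', ← Real.rpow_sub hd0]
        norm_num
      have hp := sampleProb_nonneg (G := G)
      calc 40 * sampleProb G * m / k ^ 2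
          ≤ 40 * sampleProb G * (n * d / 2) / (d ^ (0.1 : ℝ) / 2) ^ 2 := by
            gcongr
            linarith
        _ = 80 * n * d ^ (-0.05 : ℝ) := by
            rw [e, sampleProb, ← hd]
            field_simp
            norm_num
    linarith
  have hthr : 85 * n * d ^ (-0.05 : ℝ) ≤ n / d ^ (0.01 : ℝ) := by
    calc 85 * n * d ^ (-0.05 : ℝ) = n * (85 * d ^ (-0.05 : ℝ)) := by ring
      _ ≤ n * (d ^ (0.04 : ℝ) * d ^ (-0.05 : ℝ)) := by gcongr
      _ = n / d ^ (0.01 : ℝ) := by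
        rw [← Real.rpow_add hd0, div_eq_mul_inv, ← Real.rpow_neg hd0.le]
        norm_num
  have hgap : n ^ (0.8 : ℝ) / 11 ≤ s * (n * d ^ (-0.05 : ℝ)) := by
    have e : s * (n * d ^ (-0.05 : ℝ)) = n * d ^ (-0.2 : ℝ) / 11 := by
      have : d ^ (-0.2 : ℝ) = d ^ (-0.15 : ℝ) * d ^ (-0.05 : ℝ) := by
        rw [← Real.rpow_add hd0]; norm_num
      rw [hs, this]; ring
    rw [e]
    gcongr
    calc n ^ (0.8 : ℝ) = n * n ^ (-0.2 : ℝ) := by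
          rw [mul_comm, ← Real.rpow_add_one hn0.ne']; norm_num
      _ ≤ n * d ^ (-0.2 : ℝ) := mul_le_mul_of_nonneg_left
          (Real.rpow_le_rpow_of_nonpos hd0 hdn (by norm_num)) hn0.le
  have hkn : (k : ℝ) ≤ 2 * n := by
    refine hku.trans ?_
    have : d ^ (0.1 : ℝ) ≤ d ^ (1 : ℝ) := Real.rpow_le_rpow_of_exponent_le hd1 (by norm_num)
    rw [Real.rpow_one] at this
    linarith
  refine le_trans ?_ (one_sub_expectation_le_prob hΔ hk1
    (fun ω => ∑ i : Fin k, Real.exp (-(s * (85 * n * d ^ (-0.05 : ℝ)))) *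
      Real.exp (s * machineSpace ω i)) (fun ω => by positivity) fun ω hω => ?_)
  · rw [expectation_sum]
    gcongr
    calc _ ≤ ∑ _i : Fin k, Real.exp (-(n ^ (0.8 : ℝ) / 11)) := by
          refine Finset.sum_le_sum fun i _ => ?_
          rw [expectation_mul_left]
          calc _ ≤ Real.exp (-(s * (85 * n * d ^ (-0.05 : ℝ)))) *
                Real.exp (s * (84 * n * d ^ (-0.05 : ℝ))) := by
                gcongr
                refine (expectation_exp_machineSpace_le hΔ hk2 i hs0.le ?_ hsΔ).trans ?_
                · rw [hs]; linarith
                · gcongr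
            _ ≤ _ := by
                rw [← Real.exp_add, Real.exp_le_exp]
                linarith
      _ = k * Real.exp (-(n ^ (0.8 : ℝ) / 11)) := by simp
      _ ≤ 2 * n * Real.exp (-(n ^ (0.8 : ℝ) / 11)) := by gcongr
      _ ≤ _ := hexp
  · push Not at hω
    obtain ⟨i, hi⟩ := hω
    refine le_trans ?_ (Finset.single_le_sum
      (f := fun i : Fin k => Real.exp (-(s * (85 * n * d ^ (-0.05 : ℝ)))) *
        Real.exp (s * machineSpace ω i)) (fun _ _ => by positivity) (Finset.mem_univ i))
    rw [← Real.exp_add]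
    refine Real.one_le_exp ?_
    have := mul_le_mul_of_nonneg_left (hthr.trans hi.le) hs0.le
    linarith

end Bounds

end

end NearMaximal

open NearMaximal
theorem mainTheorem4 :
    ∃ c : ℝ, 0 < c ∧ ∃ C : ℝ, 0 < C ∧ ∃ Δ₀ : ℕ,
      ∀ (V : Type*) [Fintype V] [DecidableEq V] (G : SimpleGraph V) [DecidableRel G.Adj] (k : ℕ),
        1 ≤ G.maxDegree →
        |(k : ℝ) - (G.maxDegree : ℝ) ^ (0.1 : ℝ)| < 1 →
        (Δ₀ ≤ G.maxDegree →
          1 - Real.exp (-((Fintype.card V : ℝ) ^ c)) ≤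
            prob G k fun ω => ∀ i : Fin k,
              (machineSpace ω i : ℝ) ≤ (Fintype.card V : ℝ) / (G.maxDegree : ℝ) ^ c) ∧
        (1 - Real.exp (-((Fintype.card V : ℝ) ^ c)) ≤
            prob G k fun ω =>
              (totalSpace ω : ℝ) ≤ C * (Fintype.card V : ℝ) +
                (G.edgeFinset.card : ℝ) / (G.maxDegree : ℝ) ^ c) ∧
        expectation G k (fun ω => (highResDegreeCount ω : ℝ)) ≤
          C * ((Fintype.card V : ℝ) / (G.maxDegree : ℝ) ^ (0.03 : ℝ)) := by
  obtain ⟨a, ha⟩ := Filter.eventually_atTop.1 eventually_machine_bounds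
  -- The total space dictates C = 3000; the residual degree bound only needs 132.
  refine ⟨0.01, by norm_num, 3000, by norm_num, ⌈a⌉₊, ?_⟩
  intro V _ _ G _ k hΔ hk
  have hk1 := (parts_bounds (by exact_mod_cast hΔ) hk).1
  refine ⟨fun h => ?_, totalSpace_bound hΔ hk1, ?_⟩
  · exact machineSpace_bound ha hΔ hk ((Nat.le_ceil a).trans (by exact_mod_cast h))
  · refine (expectation_highResDegreeCount_le_rpow hΔ hk).trans ?_
    gcongr
    norm_num
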